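/- Let $dA$ be Lebesgue measure on $\mathbb{C}$. The Fock space $\mathcal{F}^2$ consists of the entire functions $F$ with $\int_{\mathbb C}|F(z)|^2e^{-\pi|z|^2}\,dA(z)<\infty$; $P$ denotes the orthogonal projection from $L^2(\mathbb{C},e^{-\pi|z|^2}dA)$ onto $\mathcal{F}^2$, and $e_k(z)=\pi^{k/2}z^k/\sqrt{k!}$ for $k\ge 0$. For a nonnegative $\sigma\in L^p(\mathbb{C})=L^p(\mathbb C,dA)$, $1\le p<\infty$, let $T_\sigma=P\sigma:\mathcal{F}^2\to\mathcal{F}^2$ be the Toeplitz operator with symbol $\sigma$, that is, $T_\sigma F$ is the element of $\mathcal{F}^2$ such that $$\int_{\mathbb{C}}(T_\sigma F)\,\overline{G}\,e^{-\pi|z|^2}\,dA=\int_{\mathbb{C}}\sigma F\,\overline{G}\,e^{-\pi|z|^2}\,dA\qquad\text{for all }G\in\mathcal{F}^2 .$$ Let $\lambda_1(\sigma)\ge\lambda_2(\sigma)\ge\cdots\ge 0$ be the eigenvalues of this compact, self-adjoint, nonnegative operator, in decreasing order and repeated according to multiplicity. Let $\mu(t)=|\{\sigma>t\}|$ be the distribution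 function of $\sigma$, and let $$\sigma^*(z)=\int_0^\infty\chi_{\{\sigma>t\}^*}(z)\,dt$$ be its decreasing rearrangement, where $\Omega^*$ denotes the open ball with center $0$ and the same measure as $\Omega$. For $n\ge1$ put $$G_n(s)=n-\sum_{k=0}^{n-1}(n-k)\frac{s^k}{k!}e^{-s}.$$ **Theorem.** Let $1\le p<\infty$ and let $\sigma\in L^p(\mathbb{C})$ be nonnegative and radial, i.e. $\sigma(z)=\sigma(|z|)$ (almost everywhere). Then, for every $n\ge1$, $$\sum_{k=1}^n\lambda_k(\sigma)\le\sum_{k=1}^n\lambda_k(\sigma^*)=\int_0^\infty G_n(\mu(t))\,dt,$$ where the integral on the right is finite. Moreover, for each $n\ge 1$, equality holds in the inequality if and only if $\sigma=\sigma^*$ almost everywhere. Finally, if $\sigma$ is not almost everywhere zero, then for every $n\ge1$ the eigenvalue $\lambda_n(\sigma^*)$ of $T_{\sigma^*}$ is simple, and its eigenspace is spanned by the monomial $e_{n-1}$. -/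

import Mathlib

open MeasureTheory Set
open scoped ENNReal ComplexConjugate

noncomputable section

/-- Membership in the Fock space `𝓕²(ℂ)`: entire functions `F` with
`∫ |F(z)|² e^{-π|z|²} dA(z) < ∞`. -/
def MemFock (F : ℂ → ℂ) : Prop :=
  Differentiable ℂ F ∧ Integrable (fun z : ℂ => ‖F z‖ ^ 2 * Real.exp (-Real.pi * ‖z‖ ^ 2))

/-- The integrand of the pairing `⟨f, g⟩` of `L²(ℂ, e^{-π|z|²} dA)`. -/
def fockPairing (f g : ℂ → ℂ) (z : ℂ) : ℂ :=
  f z * conj (g z) * (Real.exp (-Real.pi * ‖z‖ ^ 2) : ℂ)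

/-- `H = P f`, where `P` is the orthogonal projection onto the Fock space: `H` lies in the Fock
space and `f - H` is orthogonal to it. The function `f` itself need not lie in
`L²(ℂ, e^{-π|z|²} dA)`; it is only required that its pairing with every element of the Fock
space converges absolutely (which is automatic when `f` does lie in that space). -/
def IsFockProjection (f H : ℂ → ℂ) : Prop :=
  MemFock H ∧ ∀ G : ℂ → ℂ, MemFock G →
    Integrable (fockPairing f G) ∧ ∫ z, fockPairing f G z = ∫ z, fockPairing H G z

/-- `T_σ F = H`, where `T_σ = P σ` is the Toeplitz operator on the Fock space with symbol `σ`. -/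
def ToeplitzMapsTo (σ : ℂ → ℝ) (F H : ℂ → ℂ) : Prop :=
  MemFock F ∧ IsFockProjection (fun z => (σ z : ℂ) * F z) H

/-- `F` is an eigenfunction of `T_σ` with eigenvalue `ν`. -/
def IsToeplitzEigenfunction (σ : ℂ → ℝ) (ν : ℝ) (F : ℂ → ℂ) : Prop :=
  F ≠ 0 ∧ ToeplitzMapsTo σ F (fun z => (ν : ℂ) * F z)

/-- `λ_n(σ)` for `n ≥ 1`: the `n`-th largest eigenvalue of `T_σ`, counted with multiplicity, i.e.
the largest `t` such that there are `n` linearly independent eigenfunctions of `T_σ` with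
eigenvalues at least `t`. -/
def toeplitzEigenvalue (σ : ℂ → ℝ) (n : ℕ) : ℝ :=
  sSup {t : ℝ | ∃ F : Fin n → ℂ → ℂ, LinearIndependent ℂ F ∧
    ∀ i, ∃ ν : ℝ, t ≤ ν ∧ IsToeplitzEigenfunction σ ν (F i)}

/-- The normalized monomials `e_k(z) = π^{k/2} z^k / √(k!)`. -/
def fockMonomial (k : ℕ) (z : ℂ) : ℂ :=
  ((Real.pi ^ ((k : ℝ) / 2) / Real.sqrt (k.factorial : ℝ) : ℝ) : ℂ) * z ^ k

/-- Radial symbols, up to null sets: `σ(z)` depends on `|z|` only, for a.e. `z`. -/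
def IsRadialSymbol (σ : ℂ → ℝ) : Prop :=
  ∃ f : ℝ → ℝ, ∀ᵐ z : ℂ, σ z = f ‖z‖

/-- `Ω^*`: the open ball with center `0` and the same area as `Ω`, that is, the set of all `z`
such that the ball of radius `|z|` has area less than `|Ω|`. -/
def setRearrangement (Ω : Set ℂ) : Set ℂ :=
  {z : ℂ | ENNReal.ofReal (Real.pi * ‖z‖ ^ 2) < volume Ω}

/-- The decreasing rearrangement `σ^*(z) = ∫_0^∞ χ_{{σ > t}^*}(z) dt`. -/
def decreasingRearrangement (σ : ℂ → ℝ) (z : ℂ) : ℝ :=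
  ∫ t in Ioi (0 : ℝ), (setRearrangement {w : ℂ | t < σ w}).indicator (fun _ => (1 : ℝ)) z

/-- The distribution function `μ(t) = |{σ > t}|`. -/
def distributionFunction (σ : ℂ → ℝ) (t : ℝ) : ℝ :=
  (volume {z : ℂ | t < σ z}).toReal

/-- `G_n(s) = n - ∑_{k=0}^{n-1} (n-k) (s^k / k!) e^{-s}`. -/
def eigenvalueSumBound (n : ℕ) (s : ℝ) : ℝ :=
  (n : ℝ) - ∑ k ∈ Finset.range n,
    ((n : ℝ) - (k : ℝ)) * (s ^ k / (k.factorial : ℝ)) * Real.exp (-s)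

end

/-! ### Poisson weights and their cumulative integrals -/

/-! A radial symbol is a profile `h` of the area `s = π|z|²`, and its Toeplitz operator is diagonal
in the monomials, with eigenvalues `∫ h(s) w_k(s) ds`, where `w_k(s) = s^k e^{-s} / k!`. These tend
to zero, so the `n` largest eigenvalues correspond to a set `K` of `n` indices
(`IsAdmissibleProfile.toeplitzEigenvalue_succ`). The layer-cake formula then reduces the inequality
to a single level set: for measurable `Ω ⊆ (0, ∞)` of finite measure, `∑_{k ∈ K} ∫_Ω w_k ≤
G_n(|Ω|)`, uniformly over all `K` with `n` elements (`sum_setIntegral_poissonWeight_le`).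

To prove this, let `J_0 = 1_Ω e^{-x}` and `J_{k+1}(x) = ∫_x^∞ J_k`, so that `J_{k+1}(0) = ∫_Ω w_k`.
With `m(x) = |Ω ∩ (x, ∞)|`, the defect `D_K(x) = e^{-x} G_n(m(x)) - ∑_{k ∈ K} J_{k+1}(x)` vanishes
at infinity, so it suffices that it does not increase. Differentiation lowers every index by one.
Write `K` as `S + 1` or `{0} ∪ (S + 1)`. Then `D_K' = -D_S` minus a nonnegative slack, because
`G_{n+1}' = 1 + G_n - G_{n+1}`. Induction on the size of the indices gives `D_K ≥ 0`.

If equality holds and `K` is nonempty, then `D_K` is identically zero and the slack vanishes almost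
everywhere. This forces `Ω` to be an initial interval up to null sets.

For `σ^*` the level sets are initial intervals, so the `k`-th coefficient is `∫ Q_k(μ(t)) dt` with
the Poisson tail `Q_k(s) = ∫_0^s w_k`. Since `Q_k - Q_{k+1} = w_{k+1}`, the coefficients decrease,
strictly when `σ` is nonzero, and `G_n = ∑_{k<n} Q_k` gives the exact sum and simplicity. The
hypothesis on `L^p` enters only through finiteness of `∫ (h - ε)_+` for every `ε > 0`, a condition
that passes to the rearranged profile. -/

/-- The Poisson weight `s ^ k / k! * e ^ (-s)`. -/
noncomputable def poissonWeight (k : ℕ) (s : ℝ) : ℝ :=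
  s ^ k / (k.factorial : ℝ) * Real.exp (-s)

/-- The Poisson tail `1 - ∑_{j ≤ k} s ^ j / j! * e ^ (-s)`. -/
noncomputable def poissonTail (k : ℕ) (s : ℝ) : ℝ :=
  1 - ∑ j ∈ Finset.range (k + 1), poissonWeight j s

lemma poissonWeight_nonneg (k : ℕ) {s : ℝ} (hs : 0 ≤ s) : 0 ≤ poissonWeight k s := by
  unfold poissonWeight; positivity

lemma poissonWeight_pos (k : ℕ) {s : ℝ} (hs : 0 < s) : 0 < poissonWeight k s := by
  unfold poissonWeight; positivity

@[fun_prop]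
lemma continuous_poissonWeight (k : ℕ) : Continuous (poissonWeight k) := by
  unfold poissonWeight; fun_prop

lemma poissonWeight_le_one (k : ℕ) {s : ℝ} (hs : 0 ≤ s) : poissonWeight k s ≤ 1 := by
  have h := Real.pow_div_factorial_le_exp s hs k
  unfold poissonWeight
  rw [Real.exp_neg, ← div_eq_mul_inv]
  exact (div_le_one (Real.exp_pos s)).2 h

lemma poissonWeight_zero (s : ℝ) : poissonWeight 0 s = Real.exp (-s) := by
  simp [poissonWeight]

lemma hasDerivAt_poissonWeight_zero (s : ℝ) :
    HasDerivAt (poissonWeight 0) (-poissonWeight 0 s) s := by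
  have : poissonWeight 0 = fun s => Real.exp (-s) := by ext; simp [poissonWeight]
  rw [this]
  simpa using (hasDerivAt_neg s).exp

lemma hasDerivAt_poissonWeight_succ (k : ℕ) (s : ℝ) :
    HasDerivAt (poissonWeight (k + 1)) (poissonWeight k s - poissonWeight (k + 1) s) s := by
  have h := (((hasDerivAt_pow (k + 1) s).div_const ((k + 1).factorial : ℝ))).mul
    ((hasDerivAt_neg s).exp)
  refine h.congr_deriv ?_
  unfold poissonWeight
  rw [Nat.factorial_succ]
  have : (k.factorial : ℝ) ≠ 0 := by positivity
  push_cast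
  field_simp
  ring

/-- The derivatives `w_{j+1}' = w_j - w_{j+1}` telescope. -/
lemma hasDerivAt_poissonTail (k : ℕ) (s : ℝ) :
    HasDerivAt (poissonTail k) (poissonWeight k s) s := by
  induction k with
  | zero =>
    have : poissonTail 0 = fun s => 1 - poissonWeight 0 s := by ext; simp [poissonTail]
    rw [this]
    simpa using (hasDerivAt_poissonWeight_zero s).const_sub 1
  | succ k ih =>
    have : poissonTail (k + 1) = fun s => poissonTail k s - poissonWeight (k + 1) s := by
      ext; simp only [poissonTail, Finset.sum_range_succ _ (k + 1)]; ring
    rw [this]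
    refine (ih.sub (hasDerivAt_poissonWeight_succ k s)).congr_deriv (by ring)

lemma poissonTail_succ (k : ℕ) (s : ℝ) :
    poissonTail (k + 1) s = poissonTail k s - poissonWeight (k + 1) s := by
  simp only [poissonTail, Finset.sum_range_succ _ (k + 1)]; ring

lemma poissonTail_at_zero (k : ℕ) : poissonTail k 0 = 0 := by
  simp [poissonTail, Finset.sum_range_succ', poissonWeight]

lemma integral_poissonWeight (k : ℕ) (s : ℝ) :
    ∫ x in (0 : ℝ)..s, poissonWeight k x = poissonTail k s := by
  rw [intervalIntegral.integral_eq_sub_of_hasDerivAt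
    (fun x _ => hasDerivAt_poissonTail k x)
    ((continuous_poissonWeight k).intervalIntegrable _ _), poissonTail_at_zero, sub_zero]

lemma poissonTail_nonneg (k : ℕ) {s : ℝ} (hs : 0 ≤ s) : 0 ≤ poissonTail k s := by
  rw [← integral_poissonWeight]
  exact intervalIntegral.integral_nonneg hs fun x hx => poissonWeight_nonneg k hx.1

lemma poissonTail_le_one (k : ℕ) {s : ℝ} (hs : 0 ≤ s) : poissonTail k s ≤ 1 := by
  unfold poissonTail
  linarith [Finset.sum_nonneg fun j (_ : j ∈ Finset.range (k + 1)) => poissonWeight_nonneg j hs]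

lemma poissonTail_pos (k : ℕ) {s : ℝ} (hs : 0 < s) : 0 < poissonTail k s := by
  rw [← integral_poissonWeight]
  exact intervalIntegral.intervalIntegral_pos_of_pos_on
    ((continuous_poissonWeight k).intervalIntegrable _ _)
    (fun x hx => poissonWeight_pos k hx.1) hs

/-- The weight `w_j` is subtracted in the tail `Q_k` exactly when `j ≤ k`, hence `n - j` times among
the first `n` tails. -/
lemma eigenvalueSumBound_eq_sum (n : ℕ) (s : ℝ) :
    eigenvalueSumBound n s = ∑ k ∈ Finset.range n, poissonTail k s := by
  induction n with
  | zero => simp [eigenvalueSumBound]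
  | succ n ih =>
    rw [Finset.sum_range_succ, ← ih]
    simp only [eigenvalueSumBound, poissonTail, poissonWeight]
    have h : ∑ k ∈ Finset.range (n + 1),
        ((n + 1 : ℕ) - k : ℝ) * (s ^ k / (k.factorial : ℝ)) * Real.exp (-s)
        = ∑ k ∈ Finset.range (n + 1), ((n : ℝ) - k) * (s ^ k / (k.factorial : ℝ)) * Real.exp (-s)
          + ∑ k ∈ Finset.range (n + 1), s ^ k / (k.factorial : ℝ) * Real.exp (-s) := by
      rw [← Finset.sum_add_distrib]
      exact Finset.sum_congr rfl fun k _ => by push_cast; ring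
    rw [h, Finset.sum_range_succ (fun k : ℕ =>
      ((n : ℝ) - k) * (s ^ k / (k.factorial : ℝ)) * Real.exp (-s))]
    push_cast
    ring

lemma eigenvalueSumBound_succ (n : ℕ) (s : ℝ) :
    eigenvalueSumBound (n + 1) s = eigenvalueSumBound n s + poissonTail n s := by
  simp only [eigenvalueSumBound_eq_sum, Finset.sum_range_succ]

lemma eigenvalueSumBound_nonneg (n : ℕ) {s : ℝ} (hs : 0 ≤ s) : 0 ≤ eigenvalueSumBound n s := by
  rw [eigenvalueSumBound_eq_sum]
  exact Finset.sum_nonneg fun k _ => poissonTail_nonneg k hs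

lemma eigenvalueSumBound_le (n : ℕ) {s : ℝ} (hs : 0 ≤ s) : eigenvalueSumBound n s ≤ n := by
  rw [eigenvalueSumBound_eq_sum]
  simpa using Finset.sum_le_sum fun k (_ : k ∈ Finset.range n) => poissonTail_le_one k hs

lemma hasDerivAt_eigenvalueSumBound (n : ℕ) (s : ℝ) :
    HasDerivAt (eigenvalueSumBound n) (∑ k ∈ Finset.range n, poissonWeight k s) s := by
  have : eigenvalueSumBound n = fun s => ∑ k ∈ Finset.range n, poissonTail k s := by
    ext s; exact eigenvalueSumBound_eq_sum n s
  rw [this]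
  exact HasDerivAt.fun_sum fun k _ => hasDerivAt_poissonTail k s

/-- The derivative of `G_{n+1}` is `1 + G_n - G_{n+1}`. -/
lemma sum_poissonWeight_succ (n : ℕ) (s : ℝ) :
    ∑ k ∈ Finset.range (n + 1), poissonWeight k s
      = 1 + eigenvalueSumBound n s - eigenvalueSumBound (n + 1) s := by
  rw [eigenvalueSumBound_succ, poissonTail]; ring

/-! ### Tail integrals -/

lemma setIntegral_Ioi_eq_sub {g : ℝ → ℝ} (hg : IntegrableOn g (Ioi 0)) {x : ℝ} (hx : 0 ≤ x) :
    ∫ y in Ioi x, g y = (∫ y in Ioi 0, g y) - ∫ y in (0 : ℝ)..x, g y := by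
  rw [← intervalIntegral.integral_Ioi_sub_Ioi hg hx]; ring

lemma ae_hasDerivAt_setIntegral_Ioi {g : ℝ → ℝ} (hg : IntegrableOn g (Ioi 0)) :
    ∀ᵐ x : ℝ, 0 < x → HasDerivAt (fun x => ∫ y in Ioi x, g y) (-g x) x := by
  -- Lebesgue differentiation is applied to the extension of `g` by zero, which agrees with `g` near
  -- any positive point.
  have h1 : Integrable ((Ioi (0 : ℝ)).indicator g) := hg.integrable_indicator measurableSet_Ioi
  filter_upwards [LocallyIntegrable.ae_hasDerivAt_integral h1.locallyIntegrable] with x hx hx0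
  have h2 := (hx 0).const_sub (∫ y in Ioi 0, g y)
  rw [indicator_of_mem (mem_Ioi.2 hx0)] at h2
  refine h2.congr_of_eventuallyEq ?_
  filter_upwards [Ioi_mem_nhds hx0] with y hy
  rw [setIntegral_Ioi_eq_sub hg (le_of_lt hy), intervalIntegral.integral_of_le (le_of_lt hy),
    intervalIntegral.integral_of_le (le_of_lt hy)]
  congr 1
  exact setIntegral_congr_fun measurableSet_Ioc fun z hz => by
    rw [indicator_of_mem (mem_Ioi.2 hz.1)]

/-- Since `Ω` is only measurable, derivatives exist only almost everywhere. Absolute continuity is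
what still allows monotonicity to be read off from their sign. -/
lemma absolutelyContinuousOnInterval_setIntegral_Ioi {g : ℝ → ℝ} (hg : IntegrableOn g (Ioi 0))
    {b : ℝ} (hb : 0 ≤ b) :
    AbsolutelyContinuousOnInterval (fun x => ∫ y in Ioi x, g y) 0 b := by
  have h1 : IntervalIntegrable g volume 0 b :=
    (intervalIntegrable_iff_integrableOn_Ioc_of_le hb).2 (hg.mono_set fun x hx => hx.1)
  have h2 := h1.absolutelyContinuousOnInterval_intervalIntegral (c := 0) left_mem_uIcc
  have hc : AbsolutelyContinuousOnInterval (fun _ : ℝ => ∫ y in Ioi 0, g y) 0 b :=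
    (LipschitzWith.const (∫ y in Ioi 0, g y)).lipschitzOnWith.absolutelyContinuousOnInterval
  have h3 := hc.sub h2
  rw [absolutelyContinuousOnInterval_iff] at h3 ⊢
  intro ε hε
  obtain ⟨δ, hδ, H⟩ := h3 ε hε
  refine ⟨δ, hδ, fun E hE hlen => ?_⟩
  convert H E hE hlen using 3 with i hi
  all_goals
    have := hE.1 i hi
    rw [uIcc_of_le hb] at this
  exacts [setIntegral_Ioi_eq_sub hg this.1.1, setIntegral_Ioi_eq_sub hg this.2.1]

/-- An absolutely continuous function on `[0, b]` with a.e. nonpositive derivative does not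
increase. -/
lemma le_of_absolutelyContinuousOnInterval {f : ℝ → ℝ} {a b : ℝ} (hab : a ≤ b)
    (hf : AbsolutelyContinuousOnInterval f a b)
    (hd : ∀ᵐ x : ℝ, a < x → ∃ d ≤ 0, HasDerivAt f d x) : f b ≤ f a := by
  have h := hf.integral_deriv_eq_sub
  have : ∫ x in a..b, deriv f x ≤ 0 := by
    rw [intervalIntegral.integral_of_le hab]
    refine integral_nonpos_of_ae ((ae_restrict_iff' measurableSet_Ioc).2 ?_)
    filter_upwards [hd] with x hx hxab
    obtain ⟨d, hd, h⟩ := hx hxab.1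
    simpa [h.deriv] using hd
  linarith

/-! ### Iterated tail integrals -/

/-- Iterated tail integrals of `1_Ω(x) e ^ (-x)`. -/
noncomputable def tailIter (Ω : Set ℝ) : ℕ → ℝ → ℝ
  | 0 => Ω.indicator fun x => Real.exp (-x)
  | k + 1 => fun x => ∫ y in Ioi x, tailIter Ω k y

lemma tailIter_nonneg (Ω : Set ℝ) (k : ℕ) (x : ℝ) : 0 ≤ tailIter Ω k x := by
  induction k generalizing x with
  | zero => exact indicator_nonneg (fun _ _ => (Real.exp_pos _).le) _
  | succ k ih => exact setIntegral_nonneg measurableSet_Ioi fun y _ => ih y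

lemma integrableOn_Ioi_of_le_exp_neg {g : ℝ → ℝ} (hm : Measurable g) (h0 : ∀ x, 0 ≤ g x)
    (h1 : ∀ x, g x ≤ Real.exp (-x)) (c : ℝ) : IntegrableOn g (Ioi c) :=
  (integrableOn_exp_neg_Ioi c).mono' hm.aestronglyMeasurable
    (Filter.Eventually.of_forall fun x => by rw [Real.norm_of_nonneg (h0 x)]; exact h1 x)

/-- The bound `e^{-x}` reproduces itself under tail integration. Measurability of each further
iterate comes from its monotonicity. -/
lemma tailIter_measurable_and_le {Ω : Set ℝ} (hΩ : MeasurableSet Ω) (k : ℕ) :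
    Measurable (tailIter Ω k) ∧ ∀ x, tailIter Ω k x ≤ Real.exp (-x) := by
  induction k with
  | zero =>
    refine ⟨Measurable.indicator (by fun_prop) hΩ, fun x => ?_⟩
    exact indicator_le_self' (fun _ _ => (Real.exp_pos _).le) x
  | succ k ih =>
    have hi := integrableOn_Ioi_of_le_exp_neg ih.1 (tailIter_nonneg Ω k) ih.2
    constructor
    · refine Antitone.measurable fun x y hxy => ?_
      exact setIntegral_mono_set (hi x) (Filter.Eventually.of_forall (tailIter_nonneg Ω k))
        (Ioi_subset_Ioi hxy).eventuallyLE
    · intro x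
      calc tailIter Ω (k + 1) x ≤ ∫ y in Ioi x, Real.exp (-y) :=
            setIntegral_mono (hi x) (integrableOn_exp_neg_Ioi x) ih.2
        _ = Real.exp (-x) := integral_exp_neg_Ioi x

lemma integrableOn_tailIter {Ω : Set ℝ} (hΩ : MeasurableSet Ω) (k : ℕ) (c : ℝ) :
    IntegrableOn (tailIter Ω k) (Ioi c) :=
  integrableOn_Ioi_of_le_exp_neg (tailIter_measurable_and_le hΩ k).1 (tailIter_nonneg Ω k)
    (tailIter_measurable_and_le hΩ k).2 c

lemma lintegral_Ioc_pow_div_factorial (k : ℕ) {x y : ℝ} (hxy : x ≤ y) :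
    ∫⁻ z in Ioc x y, ENNReal.ofReal ((y - z) ^ k / (k.factorial : ℝ))
      = ENNReal.ofReal ((y - x) ^ (k + 1) / ((k + 1).factorial : ℝ)) := by
  rw [← ofReal_integral_eq_lintegral_ofReal]
  · congr 1
    rw [← intervalIntegral.integral_of_le hxy,
      intervalIntegral.integral_comp_sub_left (fun u => u ^ k / (k.factorial : ℝ)) y,
      intervalIntegral.integral_div, integral_pow, Nat.factorial_succ]
    push_cast
    simp
    field_simp
  · exact (Continuous.integrableOn_Icc (by fun_prop)).mono_set Ioc_subset_Icc_self
  · refine (ae_restrict_iff' measurableSet_Ioc).2 (Filter.Eventually.of_forall fun z hz => ?_)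
    have : 0 ≤ y - z := by linarith [hz.2]
    simp only [Pi.zero_apply]; positivity

/-- Cauchy's formula for repeated integration, by induction: Tonelli on the triangle `x < z < y`
integrates the kernel once more. Extended nonnegative integrals avoid integrability conditions. -/
lemma ofReal_tailIter_succ {Ω : Set ℝ} (hΩ : MeasurableSet Ω) (k : ℕ) (x : ℝ) :
    ENNReal.ofReal (tailIter Ω (k + 1) x) = ∫⁻ y in Ioi x,
      ENNReal.ofReal (tailIter Ω 0 y) * ENNReal.ofReal ((y - x) ^ k / (k.factorial : ℝ)) := by
  have hstep (k : ℕ) (x : ℝ) : ENNReal.ofReal (tailIter Ω (k + 1) x)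
      = ∫⁻ z in Ioi x, ENNReal.ofReal (tailIter Ω k z) :=
    ofReal_integral_eq_lintegral_ofReal (integrableOn_tailIter hΩ k x)
      (Filter.Eventually.of_forall (tailIter_nonneg Ω k))
  induction k generalizing x with
  | zero => simp [hstep]
  | succ k ih =>
    rw [hstep]
    simp_rw [ih]
    have hm := (tailIter_measurable_and_le hΩ 0).1
    set f : ℝ → ℝ≥0∞ := fun y => ENNReal.ofReal (tailIter Ω 0 y) with hf
    have hfm : Measurable f := by fun_prop
    calc ∫⁻ z in Ioi x, ∫⁻ y in Ioi z, f y * ENNReal.ofReal ((y - z) ^ k / (k.factorial : ℝ))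
        = ∫⁻ z, ∫⁻ y, {p : ℝ × ℝ | x < p.1 ∧ p.1 < p.2}.indicator (fun p => f p.2 *
            ENNReal.ofReal ((p.2 - p.1) ^ k / (k.factorial : ℝ))) (z, y) := by
          rw [← lintegral_indicator measurableSet_Ioi]
          refine lintegral_congr fun z => ?_
          by_cases hz : x < z
          · rw [indicator_of_mem (mem_Ioi.2 hz), ← lintegral_indicator measurableSet_Ioi]
            refine lintegral_congr fun y => ?_
            by_cases hy : z < y <;> simp [indicator, hy, hz]
          · rw [indicator_of_notMem (by simpa using hz)]
            simp [indicator, hz]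
      _ = ∫⁻ y, ∫⁻ z, {p : ℝ × ℝ | x < p.1 ∧ p.1 < p.2}.indicator (fun p => f p.2 *
            ENNReal.ofReal ((p.2 - p.1) ^ k / (k.factorial : ℝ))) (z, y) := by
          refine lintegral_lintegral_swap (Measurable.aemeasurable ?_)
          refine Measurable.indicator (by fun_prop) ?_
          exact (measurableSet_lt measurable_const measurable_fst).inter
            (measurableSet_lt measurable_fst measurable_snd)
      _ = ∫⁻ y in Ioi x, f y *
            ENNReal.ofReal ((y - x) ^ (k + 1) / ((k + 1).factorial : ℝ)) := by
          rw [← lintegral_indicator measurableSet_Ioi]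
          refine lintegral_congr fun y => ?_
          by_cases hy : x < y
          · rw [indicator_of_mem (mem_Ioi.2 hy), ← lintegral_Ioc_pow_div_factorial k hy.le,
              ← lintegral_const_mul _ (by fun_prop), setLIntegral_congr Ioo_ae_eq_Ioc.symm,
              ← lintegral_indicator measurableSet_Ioo]
            refine lintegral_congr fun z => ?_
            by_cases hz : x < z ∧ z < y
            · rw [indicator_of_mem (show (z, y) ∈ {p : ℝ × ℝ | x < p.1 ∧ p.1 < p.2} from hz),
                indicator_of_mem (show z ∈ Ioo x y from hz)]
            · rw [indicator_of_notMem (show (z, y) ∉ {p : ℝ × ℝ | x < p.1 ∧ p.1 < p.2} from hz),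
                indicator_of_notMem (show z ∉ Ioo x y from hz)]
          · rw [indicator_of_notMem (by simpa using hy)]
            have : ∀ z, (z, y) ∉ {p : ℝ × ℝ | x < p.1 ∧ p.1 < p.2} :=
              fun z hz => hy (hz.1.trans hz.2)
            simp [indicator_of_notMem (this _)]

/-- `∫_Ω s ^ k / k! * e ^ (-s) ds` as an iterated tail integral. -/
lemma tailIter_succ_at_zero {Ω : Set ℝ} (hΩ : MeasurableSet Ω) (h0 : Ω ⊆ Ioi 0) (k : ℕ) :
    tailIter Ω (k + 1) 0 = ∫ y in Ω, poissonWeight k y := by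
  rw [integral_eq_lintegral_of_nonneg_ae
    ((ae_restrict_iff' hΩ).2 (Filter.Eventually.of_forall fun y hy =>
      poissonWeight_nonneg k (le_of_lt (h0 hy))))
    (continuous_poissonWeight k).aestronglyMeasurable,
    ← ENNReal.toReal_ofReal (tailIter_nonneg Ω (k + 1) 0), ofReal_tailIter_succ hΩ,
    ← lintegral_indicator measurableSet_Ioi, ← lintegral_indicator hΩ]
  congr 1
  refine lintegral_congr fun y => ?_
  by_cases hy : y ∈ Ω
  · rw [indicator_of_mem (h0 hy), indicator_of_mem hy, tailIter, indicator_of_mem hy,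
      ← ENNReal.ofReal_mul (Real.exp_pos _).le, poissonWeight, sub_zero, mul_comm]
  · rw [indicator_of_notMem hy]
    by_cases hy0 : y ∈ Ioi (0 : ℝ)
    · rw [indicator_of_mem hy0, tailIter, indicator_of_notMem hy]; simp
    · rw [indicator_of_notMem hy0]

lemma ae_hasDerivAt_tailIter {Ω : Set ℝ} (hΩ : MeasurableSet Ω) (k : ℕ) :
    ∀ᵐ x : ℝ, 0 < x → HasDerivAt (tailIter Ω (k + 1)) (-tailIter Ω k x) x :=
  ae_hasDerivAt_setIntegral_Ioi (integrableOn_tailIter hΩ k 0)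

lemma absolutelyContinuousOnInterval_tailIter {Ω : Set ℝ} (hΩ : MeasurableSet Ω) (k : ℕ)
    {b : ℝ} (hb : 0 ≤ b) : AbsolutelyContinuousOnInterval (tailIter Ω (k + 1)) 0 b :=
  absolutelyContinuousOnInterval_setIntegral_Ioi (integrableOn_tailIter hΩ k 0) hb

/-! ### The measure of a set beyond a point -/

/-- The measure of the part of `Ω` beyond `x`. -/
noncomputable def massBeyond (Ω : Set ℝ) (x : ℝ) : ℝ :=
  ∫ y in Ioi x, Ω.indicator (fun _ => (1 : ℝ)) y

lemma massBeyond_eq {Ω : Set ℝ} (hΩ : MeasurableSet Ω) (x : ℝ) :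
    massBeyond Ω x = volume.real (Ω ∩ Ioi x) := by
  unfold massBeyond
  rw [setIntegral_indicator hΩ, inter_comm]; simp

lemma massBeyond_nonneg (Ω : Set ℝ) (x : ℝ) : 0 ≤ massBeyond Ω x :=
  setIntegral_nonneg measurableSet_Ioi fun _ _ => indicator_nonneg (fun _ _ => zero_le_one) _

lemma integrable_indicator_one {Ω : Set ℝ} (hΩ : MeasurableSet Ω) (hf : volume Ω ≠ ∞) :
    Integrable (Ω.indicator (fun _ => (1 : ℝ))) :=
  (integrable_indicator_iff hΩ).2 (integrableOn_const hf)

lemma ae_hasDerivAt_massBeyond {Ω : Set ℝ} (hΩ : MeasurableSet Ω) (hf : volume Ω ≠ ∞) :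
    ∀ᵐ x : ℝ, 0 < x → HasDerivAt (massBeyond Ω) (-Ω.indicator (fun _ => (1 : ℝ)) x) x :=
  ae_hasDerivAt_setIntegral_Ioi (integrable_indicator_one hΩ hf).integrableOn

lemma absolutelyContinuousOnInterval_comp_of_lipschitz {g f : ℝ → ℝ} {a b : ℝ} {C : NNReal}
    {s : Set ℝ} (hg : LipschitzOnWith C g s) (hs : ∀ x ∈ uIcc a b, f x ∈ s)
    (hf : AbsolutelyContinuousOnInterval f a b) :
    AbsolutelyContinuousOnInterval (fun x => g (f x)) a b := by
  rw [absolutelyContinuousOnInterval_iff] at hf ⊢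
  intro ε hε
  -- The `+ 1` covers Lipschitz constant zero.
  obtain ⟨δ, hδ, H⟩ := hf (ε / (C + 1)) (by positivity)
  refine ⟨δ, hδ, fun E hE hlen => ?_⟩
  have h1 := H E hE hlen
  rw [lt_div_iff₀ (by positivity)] at h1
  refine lt_of_le_of_lt ?_ h1
  rw [Finset.sum_mul]
  refine Finset.sum_le_sum fun i hi => ?_
  have h2 := hE.1 i hi
  refine (hg.dist_le_mul _ (hs _ h2.1) _ (hs _ h2.2)).trans ?_
  rw [mul_comm]
  exact mul_le_mul_of_nonneg_left (by linarith) dist_nonneg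

lemma absolutelyContinuousOnInterval_eigenvalueSumBound {Ω : Set ℝ} (hΩ : MeasurableSet Ω)
    (hf : volume Ω ≠ ∞) (n : ℕ) {b : ℝ} (hb : 0 ≤ b) :
    AbsolutelyContinuousOnInterval
      (fun x => Real.exp (-x) * eigenvalueSumBound n (massBeyond Ω x)) 0 b := by
  have h1 : AbsolutelyContinuousOnInterval (fun x : ℝ => Real.exp (-x)) 0 b :=
    ((Real.contDiff_exp.comp contDiff_neg).contDiffOn).absolutelyContinuousOnInterval
  -- The derivative is a sum of `n` Poisson weights, each in `[0, 1]` on the half-line.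
  have h2 : LipschitzOnWith n (eigenvalueSumBound n) (Ici 0) := by
    refine Convex.lipschitzOnWith_of_nnnorm_hasDerivWithin_le (convex_Ici 0)
      (fun x _ => (hasDerivAt_eigenvalueSumBound n x).hasDerivWithinAt) fun x hx => ?_
    rw [← NNReal.coe_le_coe, coe_nnnorm, Real.norm_of_nonneg
      (Finset.sum_nonneg fun k _ => poissonWeight_nonneg k hx)]
    simpa using Finset.sum_le_sum fun k (_ : k ∈ Finset.range n) => poissonWeight_le_one k hx
  exact h1.mul (absolutelyContinuousOnInterval_comp_of_lipschitz h2
    (fun x _ => massBeyond_nonneg Ω x)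
    (absolutelyContinuousOnInterval_setIntegral_Ioi
      (integrable_indicator_one hΩ hf).integrableOn hb))

/-! ### Comparison of Poisson integrals over sets of given measure -/

/-- This is the induction step on index sets: differentiating the defect of `K` produces the defect
of the lowered set `S`, and index `0` needs separate treatment. -/
lemma finset_eq_map_succ (K : Finset ℕ) : ∃ S : Finset ℕ, (∀ k ∈ S, k + 1 ∈ K) ∧
    ((0 ∉ K ∧ K = S.map (addRightEmbedding 1)) ∨
      (0 ∈ K ∧ K = insert 0 (S.map (addRightEmbedding 1)))) := by
  refine ⟨K.preimage (· + 1) (add_left_injective 1).injOn, by simp, ?_⟩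
  by_cases h : 0 ∈ K
  · refine Or.inr ⟨h, ?_⟩
    ext k
    rcases k with _ | k <;> simp [h]
  · refine Or.inl ⟨h, ?_⟩
    ext k
    rcases k with _ | k <;> simp [h]

section Comparison

variable {Ω : Set ℝ}

/-- The difference between `e ^ (-x) * G_n(|Ω ∩ (x, ∞)|)` and the corresponding sum of iterated
tail integrals. -/
noncomputable def comparisonDefect (Ω : Set ℝ) (K : Finset ℕ) (x : ℝ) : ℝ :=
  Real.exp (-x) * eigenvalueSumBound K.card (massBeyond Ω x) - ∑ k ∈ K, tailIter Ω (k + 1) x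

/-- The a.e. derivative of `comparisonDefect`. -/
noncomputable def comparisonDefectDeriv (Ω : Set ℝ) (K : Finset ℕ) (x : ℝ) : ℝ :=
  -(Real.exp (-x) * eigenvalueSumBound K.card (massBeyond Ω x))
    - Ω.indicator (fun x => Real.exp (-x) *
        ∑ k ∈ Finset.range K.card, poissonWeight k (massBeyond Ω x)) x
    + ∑ k ∈ K, tailIter Ω k x

lemma tendsto_comparisonDefect (hΩ : MeasurableSet Ω) (K : Finset ℕ) :
    Filter.Tendsto (comparisonDefect Ω K) Filter.atTop (nhds 0) := by
  have he : Filter.Tendsto (fun x : ℝ => Real.exp (-x)) Filter.atTop (nhds 0) :=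
    Real.tendsto_exp_neg_atTop_nhds_zero
  have h1 : Filter.Tendsto (fun x : ℝ => Real.exp (-x) *
      eigenvalueSumBound K.card (massBeyond Ω x)) Filter.atTop (nhds 0) := by
    refine squeeze_zero (fun x => mul_nonneg (Real.exp_pos _).le
      (eigenvalueSumBound_nonneg _ (massBeyond_nonneg Ω x))) (fun x =>
      mul_le_mul_of_nonneg_left (eigenvalueSumBound_le _ (massBeyond_nonneg Ω x))
        (Real.exp_pos _).le) ?_
    simpa using he.mul_const (K.card : ℝ)
  have h2 : Filter.Tendsto (fun x : ℝ => ∑ k ∈ K, tailIter Ω (k + 1) x)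
      Filter.atTop (nhds (∑ k ∈ K, 0)) :=
    tendsto_finsetSum _ fun k _ => squeeze_zero (tailIter_nonneg Ω (k + 1))
      (tailIter_measurable_and_le hΩ (k + 1)).2 he
  have h3 := h1.sub h2
  rw [Finset.sum_const_zero, sub_zero] at h3
  exact h3

lemma absolutelyContinuousOnInterval_comparisonDefect (hΩ : MeasurableSet Ω) (hf : volume Ω ≠ ∞) (K : Finset ℕ) {b : ℝ} (hb : 0 ≤ b) :
    AbsolutelyContinuousOnInterval (comparisonDefect Ω K) 0 b := by
  refine (absolutelyContinuousOnInterval_eigenvalueSumBound hΩ hf _ hb).sub ?_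
  induction K using Finset.induction_on with
  | empty =>
    simpa using (LipschitzWith.const (0 : ℝ)).lipschitzOnWith.absolutelyContinuousOnInterval
  | insert a s ha ih =>
    simp_rw [Finset.sum_insert ha]
    exact (absolutelyContinuousOnInterval_tailIter hΩ a hb).add ih

lemma ae_hasDerivAt_comparisonDefect (hΩ : MeasurableSet Ω) (hf : volume Ω ≠ ∞) (K : Finset ℕ) : ∀ᵐ x : ℝ, 0 < x →
    HasDerivAt (comparisonDefect Ω K) (comparisonDefectDeriv Ω K x) x := by
  have h1 : ∀ᵐ x : ℝ, ∀ k, 0 < x → HasDerivAt (tailIter Ω (k + 1)) (-tailIter Ω k x) x :=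
    ae_all_iff.2 (ae_hasDerivAt_tailIter hΩ)
  filter_upwards [h1, ae_hasDerivAt_massBeyond hΩ hf] with x hx hm h0
  have h2 := ((hasDerivAt_neg x).exp.mul ((hasDerivAt_eigenvalueSumBound K.card _).comp x (hm h0)))
  have h3 := HasDerivAt.fun_sum fun k (_ : k ∈ K) => hx k h0
  refine (h2.sub h3).congr_deriv ?_
  rw [comparisonDefectDeriv, Finset.sum_neg_distrib]
  by_cases hxΩ : x ∈ Ω
  · simp only [indicator_of_mem hxΩ, Function.comp_apply]; ring
  · simp only [indicator_of_notMem hxΩ, Function.comp_apply]; ring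

/-- The shift leaves the cardinality unchanged, so the derivative is exactly `-D_S` minus the
indicator term. Keeping that term in the bound serves the equality case. -/
lemma comparisonDefectDeriv_nonpos_of_shift {S : Finset ℕ} {x : ℝ}
    (hS : 0 ≤ comparisonDefect Ω S x) :
    comparisonDefectDeriv Ω (S.map (addRightEmbedding 1)) x ≤
      - Ω.indicator (fun x => Real.exp (-x) *
        ∑ k ∈ Finset.range S.card, poissonWeight k (massBeyond Ω x)) x := by
  unfold comparisonDefect at hS
  simp only [comparisonDefectDeriv, Finset.card_map, Finset.sum_map, addRightEmbedding_apply]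
  linarith

/-- Index `0` contributes `1_Ω e^{-x}`. On `Ω`, the identity `G_{n+1}' = 1 + G_n - G_{n+1}` cancels
it and leaves `-D_S`. Off `Ω`, `G_{n+1} = G_n + Q_n` leaves `-D_S - e^{-x} Q_n`. -/
lemma comparisonDefectDeriv_nonpos_of_insert_shift {S : Finset ℕ} {x : ℝ}
    (hS : 0 ≤ comparisonDefect Ω S x) :
    comparisonDefectDeriv Ω (insert 0 (S.map (addRightEmbedding 1))) x ≤
      - Ωᶜ.indicator (fun x => Real.exp (-x) * poissonTail S.card (massBeyond Ω x)) x := by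
  unfold comparisonDefect at hS
  have h0 : 0 ∉ S.map (addRightEmbedding 1) := by simp
  simp only [comparisonDefectDeriv, Finset.card_insert_of_notMem h0, Finset.card_map,
    Finset.sum_insert h0, Finset.sum_map, addRightEmbedding_apply, sum_poissonWeight_succ]
  have hs := eigenvalueSumBound_succ S.card (massBeyond Ω x)
  by_cases hx : x ∈ Ω
  · rw [indicator_of_mem hx, indicator_of_notMem (by simpa using hx), tailIter,
      indicator_of_mem hx]
    linarith
  · rw [indicator_of_notMem hx, indicator_of_mem (by simpa using hx), tailIter,
      indicator_of_notMem hx, hs]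
    linarith

lemma indicator_sum_poissonWeight_nonneg (n : ℕ) (x : ℝ) :
    0 ≤ Ω.indicator (fun x => Real.exp (-x) *
        ∑ k ∈ Finset.range n, poissonWeight k (massBeyond Ω x)) x :=
  indicator_nonneg (fun x _ => mul_nonneg (Real.exp_pos _).le
    (Finset.sum_nonneg fun k _ => poissonWeight_nonneg k (massBeyond_nonneg Ω x))) x

lemma indicator_poissonTail_nonneg (n : ℕ) (x : ℝ) :
    0 ≤ Ωᶜ.indicator (fun x => Real.exp (-x) * poissonTail n (massBeyond Ω x)) x :=
  indicator_nonneg (fun x _ => mul_nonneg (Real.exp_pos _).le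
    (poissonTail_nonneg _ (massBeyond_nonneg Ω x))) x

lemma antitoneOn_comparisonDefect (hΩ : MeasurableSet Ω) (hf : volume Ω ≠ ∞) (K : Finset ℕ)
    (h : ∀ x, 0 < x → comparisonDefectDeriv Ω K x ≤ 0) {a b : ℝ} (ha : 0 ≤ a) (hab : a ≤ b) :
    comparisonDefect Ω K b ≤ comparisonDefect Ω K a := by
  have hac : AbsolutelyContinuousOnInterval (comparisonDefect Ω K) a b :=
    (absolutelyContinuousOnInterval_comparisonDefect hΩ hf K (ha.trans hab)).mono (by
      rw [uIcc_of_le hab, uIcc_of_le (ha.trans hab)]; exact Icc_subset_Icc ha le_rfl)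
  refine le_of_absolutelyContinuousOnInterval hab hac ?_
  filter_upwards [ae_hasDerivAt_comparisonDefect hΩ hf K] with x hx hax
  exact ⟨_, h x (ha.trans_lt hax), hx (ha.trans_lt hax)⟩

lemma comparisonDefect_nonneg_of_deriv (hΩ : MeasurableSet Ω) (hf : volume Ω ≠ ∞) (K : Finset ℕ)
    (h : ∀ x, 0 < x → comparisonDefectDeriv Ω K x ≤ 0) {x : ℝ} (hx : 0 ≤ x) :
    0 ≤ comparisonDefect Ω K x :=
  le_of_tendsto (tendsto_comparisonDefect hΩ K) (by
    filter_upwards [Filter.eventually_ge_atTop x] with y hy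
    exact antitoneOn_comparisonDefect hΩ hf K h hx hy)

lemma comparisonDefect_nonneg (hΩ : MeasurableSet Ω) (hf : volume Ω ≠ ∞) (K : Finset ℕ) {x : ℝ} (hx : 0 ≤ x) :
    0 ≤ comparisonDefect Ω K x := by
  -- Induction is on a strict bound for the elements of `K`. Induction on the cardinality would
  -- fail, since `S + 1` and `S` are equally large.
  suffices H : ∀ N : ℕ, ∀ K : Finset ℕ, (∀ k ∈ K, k < N) → ∀ x, 0 ≤ x →
      0 ≤ comparisonDefect Ω K x by
    refine H (K.sup id + 1) K (fun k hk => ?_) x hx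
    exact Nat.lt_succ_of_le (Finset.le_sup (f := id) hk)
  intro N
  induction N with
  | zero =>
    intro K hK x _
    have : K = ∅ := Finset.eq_empty_of_forall_notMem fun k hk => absurd (hK k hk) (by simp)
    subst this
    simp [comparisonDefect, eigenvalueSumBound]
  | succ N ih =>
    intro K hK x hx
    obtain ⟨S, hSK, hS⟩ := finset_eq_map_succ K
    have hS0 := ih S fun k hk => by have := hK _ (hSK k hk); omega
    refine comparisonDefect_nonneg_of_deriv hΩ hf K (fun y hy => ?_) hx
    rcases hS with ⟨_, rfl⟩ | ⟨_, rfl⟩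
    · exact (comparisonDefectDeriv_nonpos_of_shift (hS0 y hy.le)).trans
        (neg_nonpos.2 (indicator_sum_poissonWeight_nonneg _ _))
    · exact (comparisonDefectDeriv_nonpos_of_insert_shift (hS0 y hy.le)).trans
        (neg_nonpos.2 (indicator_poissonTail_nonneg _ _))

lemma comparisonDefect_zero (h0 : Ω ⊆ Ioi 0) (hΩ : MeasurableSet Ω) (K : Finset ℕ) :
    comparisonDefect Ω K 0 = eigenvalueSumBound K.card (volume.real Ω)
      - ∑ k ∈ K, ∫ y in Ω, poissonWeight k y := by
  simp [comparisonDefect, tailIter_succ_at_zero hΩ h0, massBeyond_eq hΩ,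
    inter_eq_left.2 h0]

/-- Among sets of given measure, an initial interval maximizes the sums of Poisson integrals. -/
theorem sum_setIntegral_poissonWeight_le (hΩ : MeasurableSet Ω) (hf : volume Ω ≠ ∞)
    (h0 : Ω ⊆ Ioi 0) (K : Finset ℕ) :
    ∑ k ∈ K, ∫ y in Ω, poissonWeight k y ≤ eigenvalueSumBound K.card (volume.real Ω) := by
  have := comparisonDefect_nonneg hΩ hf K le_rfl
  rw [comparisonDefect_zero h0 hΩ] at this
  linarith

/-- If almost every point either lies in `Ω` or has no mass of `Ω` beyond it, then `Ω` is an
initial interval. -/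
lemma ae_mem_iff_lt_of_massBeyond (hΩ : MeasurableSet Ω) (hf : volume Ω ≠ ∞) (h0 : Ω ⊆ Ioi 0)
    (h : ∀ᵐ x : ℝ, 0 < x → x ∈ Ω ∨ massBeyond Ω x = 0) :
    ∀ᵐ x : ℝ, 0 < x → (x ∈ Ω ↔ x < volume.real Ω) := by
  have hsplit (x : ℝ) : volume.real Ω = volume.real (Ω ∩ Iic x) + massBeyond Ω x := by
    rw [massBeyond_eq hΩ, ← measureReal_union _ (hΩ.inter measurableSet_Ioi)
      (measure_ne_top_of_subset inter_subset_left hf)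
      (measure_ne_top_of_subset inter_subset_left hf), ← inter_union_distrib_left,
      Iic_union_Ioi, inter_univ]
    exact (Iic_disjoint_Ioi le_rfl).mono inter_subset_right inter_subset_right
  have hanti {x y : ℝ} (hxy : x ≤ y) : massBeyond Ω y ≤ massBeyond Ω x := by
    rw [massBeyond_eq hΩ, massBeyond_eq hΩ]
    exact measureReal_mono (inter_subset_inter_right _ (Ioi_subset_Ioi hxy))
      (measure_ne_top_of_subset inter_subset_left hf)
  -- If mass remains beyond `x`, it remains beyond every `y ≤ x`, so `Ω` fills `(0, x]` up to a null
  -- set and `|Ω|` is `x` plus the remaining mass. Conversely `Ω` has at most measure `x` in `(0,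
  -- x]`.
  have hpos {x : ℝ} (hx : 0 < x) : 0 < massBeyond Ω x ↔ x < volume.real Ω := by
    constructor
    · intro hm
      have hae : (Ω ∩ Iic x : Set ℝ) =ᵐ[volume] Ioc 0 x := by
        filter_upwards [h] with y hy
        refine propext ⟨fun hyΩ => ⟨h0 hyΩ.1, hyΩ.2⟩, fun hyx => ⟨?_, hyx.2⟩⟩
        rcases hy hyx.1 with h1 | h1
        · exact h1
        · have := hanti hyx.2
          linarith
      have hv : volume.real (Ω ∩ Iic x) = x := by
        rw [measureReal_congr hae]; simp [hx.le]
      rw [hsplit x, hv]; linarith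
    · intro hm
      have : volume.real (Ω ∩ Iic x) ≤ volume.real (Ioc 0 x) :=
        measureReal_mono (fun y hy => ⟨h0 hy.1, hy.2⟩) (by simp)
      rw [Real.volume_real_Ioc_of_le hx.le] at this
      linarith [hsplit x]
  have hlast : ∀ᵐ x : ℝ, x ∈ Ω → x ≤ volume.real Ω := by
    -- Positive mass beyond `|Ω|` would give `|Ω| < |Ω|` by `hpos`. The case `|Ω| = 0` is separate
    -- because `hpos` needs a positive point.
    have hz : massBeyond Ω (volume.real Ω) = 0 := by
      rcases (measureReal_nonneg (μ := volume) (s := Ω)).eq_or_lt with h1 | h1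
      · have := hsplit (volume.real Ω)
        have h2 := massBeyond_nonneg Ω (volume.real Ω)
        have h3 := measureReal_nonneg (μ := volume) (s := Ω ∩ Iic (volume.real Ω))
        linarith
      · by_contra h2
        exact lt_irrefl _ ((hpos h1).1 (lt_of_le_of_ne (massBeyond_nonneg _ _) (Ne.symm h2)))
    rw [massBeyond_eq hΩ, measureReal_eq_zero_iff
      (measure_ne_top_of_subset inter_subset_left hf)] at hz
    filter_upwards [measure_eq_zero_iff_ae_notMem.1 hz] with x hx hxΩ
    by_contra hlt
    exact hx ⟨hxΩ, not_le.1 hlt⟩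
  have hne : ∀ᵐ x : ℝ, x ≠ volume.real Ω := by simp [ae_iff]
  filter_upwards [h, hlast, hne] with x h1 h2 h3 hx
  refine ⟨fun hxΩ => lt_of_le_of_ne (h2 hxΩ) h3, fun hlt => ?_⟩
  rcases h1 hx with h4 | h4
  · exact h4
  · exact absurd h4 ((hpos hx).2 hlt).ne'

/-- Equality in `sum_setIntegral_poissonWeight_le` holds only for initial intervals. -/
theorem ae_mem_iff_lt_of_sum_setIntegral_poissonWeight_eq (hΩ : MeasurableSet Ω)
    (hf : volume Ω ≠ ∞) (h0 : Ω ⊆ Ioi 0) {K : Finset ℕ} (hK : K.Nonempty)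
    (heq : ∑ k ∈ K, ∫ y in Ω, poissonWeight k y = eigenvalueSumBound K.card (volume.real Ω)) :
    ∀ᵐ x : ℝ, 0 < x → (x ∈ Ω ↔ x < volume.real Ω) := by
  obtain ⟨S, -, hS⟩ := finset_eq_map_succ K
  have hS0 {x : ℝ} (hx : 0 < x) := comparisonDefect_nonneg hΩ hf S hx.le
  have hd : ∀ x, 0 < x → comparisonDefectDeriv Ω K x ≤ 0 := by
    intro y hy
    rcases hS with ⟨_, h⟩ | ⟨_, h⟩
    · rw [h]
      exact (comparisonDefectDeriv_nonpos_of_shift (hS0 hy)).trans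
        (neg_nonpos.2 (indicator_sum_poissonWeight_nonneg _ _))
    · rw [h]
      exact (comparisonDefectDeriv_nonpos_of_insert_shift (hS0 hy)).trans
        (neg_nonpos.2 (indicator_poissonTail_nonneg _ _))
  -- The defect is nonnegative, nonincreasing and, by the assumed equality, zero at the origin.
  have hz : ∀ x, 0 ≤ x → comparisonDefect Ω K x = 0 := by
    intro x hx
    refine le_antisymm ?_ (comparisonDefect_nonneg hΩ hf K hx)
    have h1 := antitoneOn_comparisonDefect hΩ hf K hd le_rfl hx
    rw [comparisonDefect_zero h0 hΩ, heq, sub_self] at h1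
    exact h1
  have hd0 : ∀ᵐ x : ℝ, 0 < x → comparisonDefectDeriv Ω K x = 0 := by
    filter_upwards [ae_hasDerivAt_comparisonDefect hΩ hf K] with x hx hx0
    refine (hx hx0).unique ((hasDerivAt_const x (0 : ℝ)).congr_of_eventuallyEq ?_)
    filter_upwards [Ioi_mem_nhds hx0] with y hy
    exact hz y (le_of_lt hy)
  refine ae_mem_iff_lt_of_massBeyond hΩ hf h0 ?_
  rcases hS with ⟨_, h⟩ | ⟨_, h⟩
  -- Without index `0` the slack lives on `Ω` and is strictly positive there, so `Ω` is null.
  · have hnot : ∀ᵐ x : ℝ, x ∉ Ω := by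
      filter_upwards [hd0] with x hx hxΩ
      have hx0 : 0 < x := h0 hxΩ
      have h1 := hx hx0
      rw [h] at h1
      have h2 := comparisonDefectDeriv_nonpos_of_shift (hS0 hx0)
      rw [h1, indicator_of_mem hxΩ] at h2
      have hcard : 0 < S.card := by
        rw [Finset.card_pos]
        rw [h] at hK
        simpa using hK
      have h3 : 0 < ∑ k ∈ Finset.range S.card, poissonWeight k (massBeyond Ω x) := by
        refine Finset.sum_pos' (fun k _ => poissonWeight_nonneg k (massBeyond_nonneg Ω x))
          ⟨0, Finset.mem_range.2 hcard, ?_⟩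
        rw [poissonWeight_zero]; exact Real.exp_pos _
      have := mul_pos (Real.exp_pos (-x)) h3
      linarith
    have hnull : volume Ω = 0 := measure_eq_zero_iff_ae_notMem.2 hnot
    refine Filter.Eventually.of_forall fun x _ => Or.inr ?_
    rw [massBeyond_eq hΩ, measureReal_def, measure_mono_null inter_subset_left hnull]
    simp
  -- With index `0` the slack lives off `Ω` and is positive as long as mass remains beyond the
  -- point.
  · filter_upwards [hd0] with x hx hx0
    by_contra! hcon
    have h1 := hx hx0
    rw [h] at h1
    have h2 := comparisonDefectDeriv_nonpos_of_insert_shift (hS0 hx0)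
    rw [h1, indicator_of_mem (by simpa using hcon.1)] at h2
    have := mul_pos (Real.exp_pos (-x)) (poissonTail_pos S.card
      (lt_of_le_of_ne (massBeyond_nonneg Ω x) (Ne.symm hcon.2)))
    linarith

end Comparison

/-! ### Decreasing enumerations of sequences tending to zero -/

/-- If a positive value remains outside `S`, convergence to zero leaves only finitely many
competitors. Otherwise every remaining value is zero. -/
lemma exists_max_notMem {a : ℕ → ℝ} (h0 : ∀ k, 0 ≤ a k)
    (ha : Filter.Tendsto a Filter.atTop (nhds 0)) (S : Finset ℕ) :
    ∃ m, m ∉ S ∧ ∀ j, j ∉ S → a j ≤ a m := by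
  by_cases h : ∃ j, j ∉ S ∧ 0 < a j
  · obtain ⟨j, hjS, hj⟩ := h
    obtain ⟨N, hN⟩ := Filter.eventually_atTop.1 (ha.eventually (gt_mem_nhds hj))
    have hjN : j < N := by
      by_contra hcon
      exact lt_irrefl _ (hN j (not_lt.1 hcon))
    obtain ⟨m, hm, hmax⟩ := Finset.exists_max_image ((Finset.range N).filter (· ∉ S)) a
      ⟨j, by simp [hjN, hjS]⟩
    have hjm := hmax j (by simp [hjN, hjS])
    refine ⟨m, (Finset.mem_filter.1 hm).2, fun i hi => ?_⟩
    by_cases hiN : i < N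
    · exact hmax i (by simp [hiN, hi])
    · exact (hN i (not_lt.1 hiN)).le.trans hjm
  · push Not at h
    obtain ⟨m, hm⟩ := Infinite.exists_notMem_finset S
    exact ⟨m, hm, fun j hj => (h j hj).trans (h0 m)⟩

/-- `e` enumerates indices so that `a (e 0), a (e 1), …` are the successive largest values. -/
def IsDecreasingEnumeration (a : ℕ → ℝ) (e : ℕ → ℕ) : Prop :=
  Function.Injective e ∧ ∀ i j, (∀ l < i, e l ≠ j) → a j ≤ a (e i)

lemma exists_isDecreasingEnumeration {a : ℕ → ℝ} (h0 : ∀ k, 0 ≤ a k)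
    (ha : Filter.Tendsto a Filter.atTop (nhds 0)) : ∃ e, IsDecreasingEnumeration a e := by
  choose m hm hmax using exists_max_notMem h0 ha
  -- Greedy choice: `S i` collects the first `i` indices taken, and `m (S i)` is the next one.
  let S : ℕ → Finset ℕ := fun i => Nat.rec ∅ (fun _ s => insert (m s) s) i
  have hS (i : ℕ) : S (i + 1) = insert (m (S i)) (S i) := rfl
  have hmem (i j : ℕ) : j ∈ S i ↔ ∃ l < i, m (S l) = j := by
    induction i with
    | zero => simp [S]
    | succ i ih =>
      rw [hS, Finset.mem_insert, ih]
      constructor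
      · rintro (rfl | ⟨l, hl, rfl⟩)
        · exact ⟨i, by omega, rfl⟩
        · exact ⟨l, by omega, rfl⟩
      · rintro ⟨l, hl, rfl⟩
        rcases Nat.lt_succ_iff_lt_or_eq.1 hl with h | rfl
        · exact Or.inr ⟨l, h, rfl⟩
        · exact Or.inl rfl
  refine ⟨fun i => m (S i), ?_, fun i j hj => hmax (S i) j fun hjS => ?_⟩
  · intro i j hij
    by_contra hne
    rcases lt_or_gt_of_ne hne with h | h
    · exact hm (S j) ((hmem j _).2 ⟨i, h, hij⟩)
    · exact hm (S i) ((hmem i _).2 ⟨j, h, hij.symm⟩)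
  · obtain ⟨l, hl, h⟩ := (hmem i j).1 hjS
    exact hj l hl h

lemma Antitone.isDecreasingEnumeration_id {a : ℕ → ℝ} (ha : Antitone a) :
    IsDecreasingEnumeration a id :=
  ⟨Function.injective_id, fun i j hj => ha (by
    by_contra! h; exact hj j h rfl)⟩

/-- The `n + 1`-st largest value of a sequence, as a threshold. -/
lemma IsDecreasingEnumeration.le_encard_iff {a : ℕ → ℝ} {e : ℕ → ℕ}
    (he : IsDecreasingEnumeration a e) (n : ℕ) (t : ℝ) :
    ((n + 1 : ℕ) : ℕ∞) ≤ {k | t ≤ a k}.encard ↔ t ≤ a (e n) := by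
  have hanti {i j : ℕ} (hij : i ≤ j) : a (e j) ≤ a (e i) :=
    he.2 i (e j) fun l hl h => by have := he.1 h; omega
  constructor
  · intro h
    by_contra! hlt
    -- An index outside the first `n` has value at most `a (e n)`, hence below `t`.
    have hsub : {k | t ≤ a k} ⊆ e '' (Iio n) := by
      intro k hk
      by_contra hcon
      have := he.2 n k fun l hl h => hcon ⟨l, hl, h⟩
      have hk' : t ≤ a k := hk
      linarith
    have h1 := h.trans (encard_le_encard hsub)
    rw [he.1.encard_image] at h1
    have h2 : (Iio n).encard = (n : ℕ∞) := by
      have : (Iio n) = ((Finset.range n : Finset ℕ) : Set ℕ) := by ext; simp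
      rw [this, encard_coe_eq_coe_finsetCard, Finset.card_range]
    rw [h2] at h1
    have := Nat.cast_le.1 h1
    omega
  · intro h
    have hsub : e '' (Iio (n + 1)) ⊆ {k | t ≤ a k} := by
      rintro _ ⟨l, hl, rfl⟩
      exact h.trans (hanti (Nat.lt_succ_iff.1 hl))
    refine le_trans (le_of_eq ?_) (encard_le_encard hsub)
    rw [he.1.encard_image]
    have : (Iio (n + 1)) = ((Finset.range (n + 1) : Finset ℕ) : Set ℕ) := by ext; simp
    rw [this, encard_coe_eq_coe_finsetCard, Finset.card_range]

/-! ### The area coordinate `π * |z| ^ 2` -/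

/-- The area of the disc of radius `|z|`. -/
noncomputable def areaCoord (z : ℂ) : ℝ := Real.pi * ‖z‖ ^ 2

@[fun_prop]
lemma continuous_areaCoord : Continuous areaCoord := by unfold areaCoord; fun_prop

lemma areaCoord_nonneg (z : ℂ) : 0 ≤ areaCoord z := by unfold areaCoord; positivity

lemma preimage_areaCoord_Iio (b : ℝ) :
    areaCoord ⁻¹' (Iio b) = Metric.ball 0 (Real.sqrt (b / Real.pi)) := by
  ext z
  rw [mem_preimage, mem_Iio, mem_ball_zero_iff, areaCoord,
    Real.lt_sqrt (norm_nonneg z), lt_div_iff₀ Real.pi_pos, mul_comm]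

lemma preimage_areaCoord_Iic {b : ℝ} (hb : 0 ≤ b) :
    areaCoord ⁻¹' (Iic b) = Metric.closedBall 0 (Real.sqrt (b / Real.pi)) := by
  ext z
  rw [mem_preimage, mem_Iic, mem_closedBall_zero_iff, areaCoord,
    Real.le_sqrt (norm_nonneg z) (div_nonneg hb Real.pi_pos.le), le_div_iff₀ Real.pi_pos, mul_comm]

lemma ofReal_sqrt_div_pi_sq_mul {b : ℝ} (hb : 0 ≤ b) :
    ENNReal.ofReal (Real.sqrt (b / Real.pi)) ^ 2 * NNReal.pi = ENNReal.ofReal b := by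
  rw [← ENNReal.ofReal_pow (Real.sqrt_nonneg _), Real.sq_sqrt (by positivity),
    show (NNReal.pi : ℝ≥0∞) = ENNReal.ofReal Real.pi by
      rw [← NNReal.coe_real_pi, ENNReal.ofReal_coe_nnreal],
    ← ENNReal.ofReal_mul (by positivity), div_mul_cancel₀ _ Real.pi_ne_zero]

/-- The area coordinate pushes Lebesgue measure forward to Lebesgue measure on the half-line. -/
lemma measurePreserving_areaCoord :
    MeasurePreserving areaCoord volume (volume.restrict (Ioi 0)) := by
  refine ⟨continuous_areaCoord.measurable, (Real.measure_ext_Ioo_rat fun a b => ?_).symm⟩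
  rw [Measure.map_apply continuous_areaCoord.measurable measurableSet_Ioo,
    Measure.restrict_apply measurableSet_Ioo]
  generalize (a : ℝ) = a
  generalize (b : ℝ) = b
  rcases le_or_gt b 0 with hb | hb
  · have h1 : Ioo a b ∩ Ioi 0 = ∅ := by
      ext x; simp only [mem_inter_iff, mem_Ioo, mem_Ioi, mem_empty_iff_false, iff_false]
      intro h; linarith [h.1.2, h.2]
    have h2 : areaCoord ⁻¹' Ioo a b = ∅ := by
      ext z; simp only [mem_preimage, mem_Ioo, mem_empty_iff_false, iff_false]
      intro h; linarith [h.2, areaCoord_nonneg z]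
    rw [h1, h2]; simp
  · rcases lt_or_ge a 0 with ha | ha
    · have h1 : Ioo a b ∩ Ioi 0 = Ioo 0 b := by
        ext x; simp only [mem_inter_iff, mem_Ioo, mem_Ioi]
        exact ⟨fun h => ⟨h.2, h.1.2⟩, fun h => ⟨⟨ha.trans h.1, h.2⟩, h.1⟩⟩
      have h2 : areaCoord ⁻¹' Ioo a b = areaCoord ⁻¹' Iio b := by
        ext z; simp only [mem_preimage, mem_Ioo, mem_Iio, and_iff_right_iff_imp]
        exact fun _ => ha.trans_le (areaCoord_nonneg z)
      rw [h1, h2, preimage_areaCoord_Iio b, Complex.volume_ball,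
        ofReal_sqrt_div_pi_sq_mul hb.le, Real.volume_Ioo, sub_zero]
    · have h1 : Ioo a b ∩ Ioi 0 = Ioo a b := inter_eq_left.2 fun x hx => ha.trans_lt hx.1
      rcases le_or_gt b a with hab | hab
      · simp [Ioo_eq_empty_of_le hab]
      have h2 : areaCoord ⁻¹' Ioo a b = areaCoord ⁻¹' Iio b \ areaCoord ⁻¹' Iic a := by
        ext z; simp only [mem_preimage, mem_Ioo, mem_Iio, mem_sdiff, mem_Iic, not_le]
        exact and_comm
      rw [h1, h2, measure_sdiff, preimage_areaCoord_Iio b, preimage_areaCoord_Iic ha,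
        Complex.volume_ball, Complex.volume_closedBall, ofReal_sqrt_div_pi_sq_mul hb.le,
        ofReal_sqrt_div_pi_sq_mul ha, Real.volume_Ioo, ENNReal.ofReal_sub _ ha]
      · exact preimage_mono fun x hx => lt_of_le_of_lt hx hab
      · exact (continuous_areaCoord.measurable measurableSet_Iic).nullMeasurableSet
      · rw [preimage_areaCoord_Iic ha, Complex.volume_closedBall, ofReal_sqrt_div_pi_sq_mul ha]
        exact ENNReal.ofReal_ne_top

lemma ae_areaCoord_of_ae {p : ℝ → Prop} (h : ∀ᵐ s : ℝ, 0 < s → p s) :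
    ∀ᵐ z : ℂ, p (areaCoord z) :=
  measurePreserving_areaCoord.quasiMeasurePreserving.ae
    ((ae_restrict_iff' measurableSet_Ioi).2 h)

/-! ### Power series coefficients of entire functions -/

/-- The `k`-th coefficient of the power series of `F` at the origin. -/
noncomputable def entireCoeff (F : ℂ → ℂ) (k : ℕ) : ℂ := (cauchyPowerSeries F 0 1).coeff k

lemma hasSum_entireCoeff {F : ℂ → ℂ} (hF : Differentiable ℂ F) (z : ℂ) :
    HasSum (fun k => entireCoeff F k * z ^ k) (F z) := by
  have h := (hF.hasFPowerSeriesOnBall 0 (R := 1) one_pos).hasSum (y := z) (by simp)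
  simp only [NNReal.coe_one, FormalMultilinearSeries.apply_eq_pow_smul_coeff, smul_eq_mul,
    zero_add] at h
  simpa only [entireCoeff, mul_comm] using h

lemma entireCoeff_zero {F : ℂ → ℂ} (hF : Differentiable ℂ F) : entireCoeff F 0 = F 0 := by
  have h := (hasSum_entireCoeff hF 0)
  have h2 := hasSum_single (f := fun k => entireCoeff F k * (0 : ℂ) ^ k) 0
    (fun k hk => by simp [hk])
  simpa using h2.unique h

/-- On the circle of radius `r` the conjugate of `z` is `r² / z`, which turns the angular integral
into Cauchy's coefficient formula. -/
lemma integral_circleMap_mul_exp {F : ℂ → ℂ} (hF : Differentiable ℂ F) (k : ℕ) {r : ℝ}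
    (hr : 0 < r) :
    ∫ θ in Ioo (-Real.pi) Real.pi, F (circleMap 0 r θ) * conj (circleMap 0 r θ) ^ k
      = 2 * Real.pi * entireCoeff F k * (r : ℂ) ^ (2 * k) := by
  have hcoeff : entireCoeff F k = (2 * Real.pi * Complex.I : ℂ)⁻¹ •
      ∮ z in C(0, r), (1 / (z - 0)) ^ k • (z - 0)⁻¹ • F z := by
    rw [← cauchyPowerSeries_apply, entireCoeff, FormalMultilinearSeries.apply_eq_pow_smul_coeff,
      one_pow, one_smul]
    have h1 := hF.hasFPowerSeriesOnBall 0 (R := 1) one_pos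
    have h2 := hF.hasFPowerSeriesOnBall 0 (R := ⟨r, hr.le⟩) hr
    -- Uniqueness of the power series lets the coefficient, defined on the unit circle, be computed
    -- on the circle of radius `r`.
    have := h1.hasFPowerSeriesAt.eq_formalMultilinearSeries h2.hasFPowerSeriesAt
    simp only [NNReal.coe_one] at this
    rw [this]
    rfl
  have hrc : (r : ℂ) ≠ 0 := by exact_mod_cast hr.ne'
  have hper : Function.Periodic
      (fun θ : ℝ => F (circleMap 0 r θ) * conj (circleMap 0 r θ) ^ k) (2 * Real.pi) := by
    intro θ
    simp only [periodic_circleMap 0 r θ]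
  have hI : ∮ z in C(0, r), (1 / (z - 0)) ^ k • (z - 0)⁻¹ • F z
      = Complex.I * ((r : ℂ) ^ (2 * k))⁻¹ *
        ∫ θ in (0 : ℝ)..2 * Real.pi, F (circleMap 0 r θ) * conj (circleMap 0 r θ) ^ k := by
    rw [circleIntegral, ← intervalIntegral.integral_const_mul]
    refine intervalIntegral.integral_congr fun θ _ => ?_
    have hz : circleMap 0 r θ ≠ 0 := circleMap_ne_center hr.ne'
    have hcz : circleMap 0 r θ * conj (circleMap 0 r θ) = (r : ℂ) ^ 2 := by
      rw [Complex.mul_conj, Complex.normSq_eq_norm_sq, norm_circleMap_zero]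
      simp [abs_of_pos hr]
    have hconj : conj (circleMap 0 r θ) = (r : ℂ) ^ 2 / circleMap 0 r θ := by
      rw [← hcz]; field_simp
    simp only [deriv_circleMap, smul_eq_mul, sub_zero, hconj, div_pow, one_div, pow_mul, inv_pow]
    field_simp
  have hshift : ∫ θ in Ioo (-Real.pi) Real.pi,
      F (circleMap 0 r θ) * conj (circleMap 0 r θ) ^ k
      = ∫ θ in (0 : ℝ)..2 * Real.pi, F (circleMap 0 r θ) * conj (circleMap 0 r θ) ^ k := by
    rw [← integral_Ioc_eq_integral_Ioo,
      ← intervalIntegral.integral_of_le (by linarith [Real.pi_pos])]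
    have := hper.intervalIntegral_add_eq (-Real.pi) 0
    rw [zero_add] at this
    rw [← this]
    congr 1
    ring
  rw [hshift, hcoeff, hI, smul_eq_mul]
  have hpi : (Real.pi : ℂ) ≠ 0 := by exact_mod_cast Real.pi_ne_zero
  have := Complex.I_ne_zero
  field_simp

lemma integrableOn_polarCoord_target {H : ℂ → ℂ} (hm : Measurable H) (hH : Integrable H) :
    IntegrableOn (fun p : ℝ × ℝ => p.1 • H (Complex.polarCoord.symm p)) polarCoord.target := by
  have hms : Measurable fun p : ℝ × ℝ => Complex.polarCoord.symm p := by
    simp only [Complex.polarCoord_symm_apply]; fun_prop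
  refine ⟨(measurable_fst.smul (hm.comp hms)).aestronglyMeasurable, ?_⟩
  have h := Complex.lintegral_comp_polarCoord_symm fun z => ‖H z‖ₑ
  have h2 : ∫⁻ z, ‖H z‖ₑ < ∞ := hH.2
  rw [← h] at h2
  refine lt_of_le_of_lt (le_of_eq ?_) h2
  refine setLIntegral_congr_fun (by
    rw [polarCoord_target]; exact measurableSet_Ioi.prod measurableSet_Ioo) fun p hp => ?_
  have hp1 : 0 < p.1 := by rw [polarCoord_target] at hp; exact hp.1
  simp only [enorm_smul, smul_eq_mul]
  rw [Real.enorm_of_nonneg hp1.le]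

lemma integral_eq_integral_polar {H : ℂ → ℂ} (hm : Measurable H) (hH : Integrable H) :
    ∫ z, H z = ∫ r in Ioi (0 : ℝ), ∫ θ in Ioo (-Real.pi) Real.pi, r • H (circleMap 0 r θ) := by
  have h := integrableOn_polarCoord_target hm hH
  rw [← Complex.integral_comp_polarCoord_symm, polarCoord_target, Measure.volume_eq_prod,
    setIntegral_prod]
  · simp only [Complex.polarCoord_symm_apply, circleMap_zero, Complex.exp_mul_I,
      Complex.ofReal_cos, Complex.ofReal_sin]
  · rw [← polarCoord_target, ← Measure.volume_eq_prod]; exact h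

/-- Pairing an entire function with a monomial against a radial weight picks out one
coefficient. -/
lemma integral_radial_mul_entire {F : ℂ → ℂ} (hF : Differentiable ℂ F) (k : ℕ) {g : ℝ → ℝ}
    (hg : Measurable g)
    (h1 : Integrable fun z : ℂ => (g (areaCoord z) : ℂ) * (F z * conj z ^ k))
    (h2 : Integrable fun z : ℂ => ((g (areaCoord z) * ‖z‖ ^ (2 * k) : ℝ) : ℂ)) :
    ∫ z : ℂ, (g (areaCoord z) : ℂ) * (F z * conj z ^ k)
      = entireCoeff F k * ((∫ z : ℂ, g (areaCoord z) * ‖z‖ ^ (2 * k) : ℝ) : ℂ) := by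
  have hFm : Measurable F := hF.continuous.measurable
  have hgm : Measurable fun z : ℂ => g (areaCoord z) := hg.comp continuous_areaCoord.measurable
  have hconj : Measurable fun z : ℂ => conj z := Complex.continuous_conj.measurable
  rw [← integral_complex_ofReal, integral_eq_integral_polar (by fun_prop) h1,
    integral_eq_integral_polar (by fun_prop) h2, ← integral_const_mul]
  refine setIntegral_congr_fun measurableSet_Ioi fun r hr => ?_
  have hr : 0 < r := hr
  have hq (θ : ℝ) : areaCoord (circleMap 0 r θ) = Real.pi * r ^ 2 := by
    simp [areaCoord]
  have hn (θ : ℝ) : ‖circleMap 0 r θ‖ = r := by simp [abs_of_pos hr]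
  simp only [hq, hn]
  rw [setIntegral_const, integral_smul, integral_const_mul, integral_circleMap_mul_exp hF k hr,
    Real.volume_real_Ioo_of_le (by linarith [Real.pi_pos])]
  simp only [Complex.real_smul]
  push_cast
  ring

/-! ### Elements of the Fock space -/

lemma memFock_iff (F : ℂ → ℂ) : MemFock F ↔
    Differentiable ℂ F ∧ Integrable (fun z : ℂ => ‖F z‖ ^ 2 * Real.exp (-areaCoord z)) := by
  simp only [MemFock, areaCoord, neg_mul]

lemma fockPairing_eq (f g : ℂ → ℂ) (z : ℂ) :
    fockPairing f g z = f z * conj (g z) * (Real.exp (-areaCoord z) : ℂ) := by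
  simp only [fockPairing, areaCoord, neg_mul]

/-- The area mean value property of entire functions. -/
lemma norm_le_integral_ball {F : ℂ → ℂ} (hF : Differentiable ℂ F) (z : ℂ) :
    Real.pi * ‖F z‖ ≤ ∫ w in Metric.ball z 1, ‖F w‖ := by
  have hFz : Differentiable ℂ fun w => F (w + z) := hF.comp (differentiable_id.add_const z)
  have hg : Measurable ((Iio Real.pi).indicator fun _ => (1 : ℝ)) :=
    measurable_const.indicator measurableSet_Iio
  have hball : areaCoord ⁻¹' (Iio Real.pi) = Metric.ball 0 1 := by
    rw [preimage_areaCoord_Iio, div_self Real.pi_ne_zero, Real.sqrt_one]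
  have hind (w : ℂ) : (Iio Real.pi).indicator (fun _ => (1 : ℝ)) (areaCoord w)
      = (Metric.ball (0 : ℂ) 1).indicator (fun _ => (1 : ℝ)) w := by
    rw [← hball]; rfl
  have hfin : volume (Metric.ball (0 : ℂ) 1) ≠ ∞ := measure_ball_lt_top.ne
  have h2 : Integrable fun w : ℂ =>
      (((Iio Real.pi).indicator (fun _ => (1 : ℝ)) (areaCoord w) * ‖w‖ ^ (2 * 0) : ℝ) : ℂ) := by
    simp only [hind, mul_zero, pow_zero, mul_one]
    exact ((integrable_indicator_iff Metric.isOpen_ball.measurableSet).2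
      (integrableOn_const hfin)).ofReal
  have heq (w : ℂ) : (((Iio Real.pi).indicator (fun _ => (1 : ℝ)) (areaCoord w) : ℝ) : ℂ) *
      (F (w + z) * conj w ^ 0) = (Metric.ball (0 : ℂ) 1).indicator (fun w => F (w + z)) w := by
    rw [hind]
    by_cases hw : w ∈ Metric.ball (0 : ℂ) 1
    · rw [indicator_of_mem hw, indicator_of_mem hw]; simp
    · rw [indicator_of_notMem hw, indicator_of_notMem hw]; simp
  have hint : IntegrableOn (fun w => F (w + z)) (Metric.ball (0 : ℂ) 1) :=
    (hFz.continuous.continuousOn.integrableOn_compact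
      (isCompact_closedBall (0 : ℂ) 1)).mono_set Metric.ball_subset_closedBall
  have h1 : Integrable fun w : ℂ =>
      (((Iio Real.pi).indicator (fun _ => (1 : ℝ)) (areaCoord w) : ℝ) : ℂ) *
        (F (w + z) * conj w ^ 0) := by
    simp only [heq]
    exact (integrable_indicator_iff Metric.isOpen_ball.measurableSet).2 hint
  -- Mean value property as the case `k = 0` of the coefficient formula, with the unit disc as
  -- radial weight.
  have h := integral_radial_mul_entire hFz 0 hg h1 h2
  simp only [heq] at h
  simp only [hind, mul_zero, pow_zero, mul_one, entireCoeff_zero hFz, zero_add] at h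
  rw [integral_indicator Metric.isOpen_ball.measurableSet,
    integral_indicator Metric.isOpen_ball.measurableSet, setIntegral_const] at h
  have hvol : volume.real (Metric.ball (0 : ℂ) 1) = Real.pi := by
    rw [measureReal_def, Complex.volume_ball]; simp
  rw [hvol, smul_eq_mul, mul_one] at h
  have hle := norm_integral_le_integral_norm (μ := volume.restrict (Metric.ball (0 : ℂ) 1))
    (fun w => F (w + z))
  rw [h, norm_mul, Complex.norm_real, Real.norm_of_nonneg Real.pi_pos.le, mul_comm] at hle
  refine hle.trans (le_of_eq ?_)
  have hpre : (fun w : ℂ => w + z) ⁻¹' Metric.ball z 1 = Metric.ball 0 1 := by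
    ext w; simp [Metric.mem_ball, dist_eq_norm]
  rw [← (measurePreserving_add_right volume z).setIntegral_preimage_emb
    (measurableEmbedding_addRight z) (fun w => ‖F w‖) (Metric.ball z 1), hpre]

/-- Fock functions grow at most like `e ^ (π (|z| + 1) ^ 2 / 2)`. -/
lemma MemFock.norm_sq_le {G : ℂ → ℂ} (hG : MemFock G) :
    ∃ C : ℝ, 0 ≤ C ∧ ∀ z, ‖G z‖ ^ 2 ≤ C * Real.exp (Real.pi * (‖z‖ + 1) ^ 2) := by
  obtain ⟨hd, hi⟩ := (memFock_iff G).1 hG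
  set I := ∫ z : ℂ, ‖G z‖ ^ 2 * Real.exp (-areaCoord z) with hI
  have hI0 : 0 ≤ I := integral_nonneg fun z => by positivity
  -- The mean value inequality is applied to `G²` on the unit disc about `z`, where `|w| ≤ |z| + 1`
  -- bounds the Gaussian weight from below.
  refine ⟨I / Real.pi, by positivity, fun z => ?_⟩
  have h1 := norm_le_integral_ball (hd.pow 2) z
  have h2 : ∫ w in Metric.ball z 1, ‖G w ^ 2‖ ≤
      ∫ w in Metric.ball z 1, Real.exp (Real.pi * (‖z‖ + 1) ^ 2) *
        (‖G w‖ ^ 2 * Real.exp (-areaCoord w)) := by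
    refine setIntegral_mono_on ?_ (hi.const_mul _).integrableOn Metric.isOpen_ball.measurableSet
      fun w hw => ?_
    · exact ((hd.continuous.pow 2).norm.continuousOn.integrableOn_compact
        (isCompact_closedBall z 1)).mono_set Metric.ball_subset_closedBall
    · have hw1 : ‖w‖ ≤ ‖z‖ + 1 := by
        have := norm_sub_norm_le w z
        rw [Metric.mem_ball, dist_eq_norm] at hw
        linarith
      rw [norm_pow, mul_left_comm, ← Real.exp_add]
      refine le_mul_of_one_le_right (by positivity) (Real.one_le_exp ?_)
      have : Real.pi * ‖w‖ ^ 2 ≤ Real.pi * (‖z‖ + 1) ^ 2 := by gcongr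
      unfold areaCoord
      linarith
  have h3 : ∫ w in Metric.ball z 1, Real.exp (Real.pi * (‖z‖ + 1) ^ 2) *
        (‖G w‖ ^ 2 * Real.exp (-areaCoord w)) ≤ Real.exp (Real.pi * (‖z‖ + 1) ^ 2) * I := by
    rw [integral_const_mul]
    refine mul_le_mul_of_nonneg_left ?_ (Real.exp_pos _).le
    exact setIntegral_le_integral hi (Filter.Eventually.of_forall fun z => by positivity)
  have h4 := h1.trans (h2.trans h3)
  simp only [Pi.pow_apply, norm_pow] at h4
  rw [div_mul_eq_mul_div, le_div_iff₀ Real.pi_pos]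
  linarith

/-! ### Admissible radial profiles -/

/-- Nonnegative profiles on the half-line lying in `L¹ + ε L^∞` for every `ε > 0`. -/
structure IsAdmissibleProfile (h : ℝ → ℝ) : Prop where
  measurable : Measurable h
  nonneg : ∀ s, 0 ≤ h s
  lintegral_sub_ne_top : ∀ ε > 0, ∫⁻ s in Ioi 0, ENNReal.ofReal (h s - ε) ≠ ∞

/-- The eigenvalue of `T_σ` on the `k`-th monomial, for `σ(z) = h (π |z| ^ 2)`. -/
noncomputable def profileCoeff (h : ℝ → ℝ) (k : ℕ) : ℝ :=
  ∫ s in Ioi 0, h s * poissonWeight k s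

lemma integrable_max_sub_zero {α : Type*} [MeasurableSpace α] {μ : Measure α} {f : α → ℝ}
    (hf : Measurable f) {ε : ℝ} (h1 : ∫⁻ x, ENNReal.ofReal (f x - ε) ∂μ ≠ ∞) :
    Integrable (fun x => max (f x - ε) 0) μ := by
  refine ⟨((hf.sub_const _).max measurable_const).aestronglyMeasurable, ?_⟩
  refine lt_of_le_of_lt (le_of_eq ?_) (lt_top_iff_ne_top.2 h1)
  refine lintegral_congr fun x => ?_
  rw [Real.enorm_of_nonneg (le_max_right _ _)]
  rcases le_total (f x - ε) 0 with h | h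
  · rw [max_eq_right h, ENNReal.ofReal_of_nonpos h, ENNReal.ofReal_zero]
  · rw [max_eq_left h]

/-- Since `f ≤ 1 + (f - 1)_+`, integrability of `X` controls the first part and boundedness of `X`
the second. -/
lemma integrable_mul_of_lintegral_sub_ne_top {α : Type*} [MeasurableSpace α] {μ : Measure α}
    {f : α → ℝ} (hf : Measurable f) (h0 : ∀ x, 0 ≤ f x)
    (h1 : ∫⁻ x, ENNReal.ofReal (f x - 1) ∂μ ≠ ∞) {X : α → ℝ} (hX : Integrable X μ) {B : ℝ}
    (hB : ∀ᵐ x ∂μ, ‖X x‖ ≤ B) : Integrable (fun x => f x * X x) μ := by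
  have hi := integrable_max_sub_zero hf h1
  refine (hX.norm.add (hi.mul_const B)).mono' (hf.aestronglyMeasurable.mul hX.1) ?_
  filter_upwards [hB] with x hx
  rw [norm_mul, Real.norm_of_nonneg (h0 x), Pi.add_apply]
  have h2 : f x ≤ 1 + max (f x - 1) 0 := by linarith [le_max_left (f x - 1) 0]
  calc f x * ‖X x‖ ≤ (1 + max (f x - 1) 0) * ‖X x‖ := by gcongr
    _ = ‖X x‖ + max (f x - 1) 0 * ‖X x‖ := by ring
    _ ≤ ‖X x‖ + max (f x - 1) 0 * B := by
      gcongr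

lemma integrableOn_poissonWeight (k : ℕ) : IntegrableOn (poissonWeight k) (Ioi 0) := by
  have h := (Real.GammaIntegral_convergent (s := (k : ℝ) + 1) (by positivity)).div_const
    (k.factorial : ℝ)
  refine IntegrableOn.congr_fun h (fun s _ => ?_) measurableSet_Ioi
  simp only [add_sub_cancel_right, Real.rpow_natCast, poissonWeight]
  ring

lemma integral_Ioi_poissonWeight (k : ℕ) : ∫ s in Ioi (0 : ℝ), poissonWeight k s = 1 := by
  have h := Real.Gamma_eq_integral (s := (k : ℝ) + 1) (by positivity)
  rw [Real.Gamma_nat_eq_factorial] at h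
  have h2 : ∀ s : ℝ, poissonWeight k s
      = Real.exp (-s) * s ^ ((k : ℝ) + 1 - 1) / (k.factorial : ℝ) := by
    intro s
    simp only [add_sub_cancel_right, Real.rpow_natCast, poissonWeight]
    ring
  simp only [h2]
  rw [integral_div, ← h, div_self (by positivity)]

lemma norm_poissonWeight_le_one (k : ℕ) :
    ∀ᵐ s ∂volume.restrict (Ioi (0 : ℝ)), ‖poissonWeight k s‖ ≤ 1 :=
  (ae_restrict_iff' measurableSet_Ioi).2 (Filter.Eventually.of_forall fun s hs => by
    rw [Real.norm_of_nonneg (poissonWeight_nonneg k (le_of_lt hs))]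
    exact poissonWeight_le_one k (le_of_lt hs))

namespace IsAdmissibleProfile

variable {h : ℝ → ℝ}

lemma integrableOn (hh : IsAdmissibleProfile h) (k : ℕ) :
    IntegrableOn (fun s => h s * poissonWeight k s) (Ioi 0) :=
  integrable_mul_of_lintegral_sub_ne_top hh.measurable hh.nonneg
    (hh.lintegral_sub_ne_top 1 one_pos) (integrableOn_poissonWeight k)
    (norm_poissonWeight_le_one k)

lemma profileCoeff_nonneg (hh : IsAdmissibleProfile h) (k : ℕ) : 0 ≤ profileCoeff h k :=
  setIntegral_nonneg measurableSet_Ioi fun s hs =>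
    mul_nonneg (hh.nonneg s) (poissonWeight_nonneg k (le_of_lt hs))

/-- Split `h ≤ (h - ε/2)_+ + ε/2`. The first part is integrable and `w_k → 0` pointwise with `w_k ≤
1`, so dominated convergence applies. The second contributes `ε/2`, as each weight has mass one. -/
lemma tendsto_profileCoeff (hh : IsAdmissibleProfile h) :
    Filter.Tendsto (profileCoeff h) Filter.atTop (nhds 0) := by
  rw [Metric.tendsto_atTop]
  intro ε hε
  set u : ℝ → ℝ := fun s => max (h s - ε / 2) 0 with hu
  have hum : Measurable u := (hh.measurable.sub_const _).max measurable_const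
  have hui : IntegrableOn u (Ioi 0) :=
    integrable_max_sub_zero hh.measurable (hh.lintegral_sub_ne_top (ε / 2) (by positivity))
  have hlim : Filter.Tendsto (fun k => ∫ s in Ioi (0 : ℝ), u s * poissonWeight k s)
      Filter.atTop (nhds (∫ s in Ioi (0 : ℝ), (0 : ℝ))) := by
    refine tendsto_integral_of_dominated_convergence u
      (fun k => (hum.mul (continuous_poissonWeight k).measurable).aestronglyMeasurable) hui
      (fun k => ?_) (Filter.Eventually.of_forall fun s => ?_)
    · filter_upwards [norm_poissonWeight_le_one k] with s hs
      rw [norm_mul, Real.norm_of_nonneg (le_max_right _ _)]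
      exact mul_le_of_le_one_right (le_max_right _ _) hs
    · have h1 := (FloorSemiring.tendsto_pow_div_factorial_atTop s).mul_const (Real.exp (-s))
      simpa [poissonWeight] using h1.const_mul (u s)
  rw [integral_zero, Metric.tendsto_atTop] at hlim
  obtain ⟨N, hN⟩ := hlim (ε / 2) (by positivity)
  refine ⟨N, fun k hk => ?_⟩
  have h1 := hN k hk
  rw [Real.dist_0_eq_abs] at h1 ⊢
  rw [abs_of_nonneg (hh.profileCoeff_nonneg k)]
  have hup : IntegrableOn (fun s => u s * poissonWeight k s) (Ioi 0) := by
    refine hui.mono' (hum.mul (continuous_poissonWeight k).measurable).aestronglyMeasurable ?_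
    filter_upwards [norm_poissonWeight_le_one k] with s hs
    rw [norm_mul, Real.norm_of_nonneg (le_max_right _ _)]
    exact mul_le_of_le_one_right (le_max_right _ _) hs
  have h2 : profileCoeff h k ≤
      ∫ s in Ioi (0 : ℝ), (u s * poissonWeight k s + ε / 2 * poissonWeight k s) := by
    refine setIntegral_mono_on (hh.integrableOn k)
      (hup.add ((integrableOn_poissonWeight k).const_mul _)) measurableSet_Ioi fun s hs => ?_
    have h3 : h s ≤ u s + ε / 2 := by simp only [hu]; linarith [le_max_left (h s - ε / 2) 0]
    rw [← add_mul]
    exact mul_le_mul_of_nonneg_right h3 (poissonWeight_nonneg k (le_of_lt hs))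
  rw [integral_add hup ((integrableOn_poissonWeight k).const_mul _), integral_const_mul,
    integral_Ioi_poissonWeight, mul_one] at h2
  have := le_abs_self (∫ s in Ioi (0 : ℝ), u s * poissonWeight k s)
  linarith

lemma lintegral_areaCoord_sub_ne_top (hh : IsAdmissibleProfile h) {ε : ℝ} (hε : 0 < ε) :
    ∫⁻ z, ENNReal.ofReal (h (areaCoord z) - ε) ≠ ∞ := by
  have hm := hh.measurable
  rw [measurePreserving_areaCoord.lintegral_comp
    (f := fun s => ENNReal.ofReal (h s - ε)) (by fun_prop)]
  exact hh.lintegral_sub_ne_top ε hε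

end IsAdmissibleProfile

/-! ### Pairings with monomials -/

lemma poissonWeight_areaCoord (k : ℕ) (z : ℂ) :
    poissonWeight k (areaCoord z)
      = Real.pi ^ k / (k.factorial : ℝ) * (‖z‖ ^ (2 * k) * Real.exp (-areaCoord z)) := by
  rw [poissonWeight]
  nth_rewrite 1 [areaCoord]
  rw [mul_pow, ← pow_mul]; ring

lemma integrable_norm_pow_mul_exp (k : ℕ) :
    Integrable fun z : ℂ => ‖z‖ ^ (2 * k) * Real.exp (-areaCoord z) := by
  have h1 : Integrable fun z : ℂ => poissonWeight k (areaCoord z) :=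
    measurePreserving_areaCoord.integrable_comp_of_integrable (integrableOn_poissonWeight k)
  refine (h1.const_mul ((k.factorial : ℝ) / Real.pi ^ k)).congr
    (Filter.Eventually.of_forall fun z => ?_)
  have := Real.pi_ne_zero
  simp only [poissonWeight_areaCoord]
  field_simp

lemma memFock_pow (k : ℕ) : MemFock fun z => z ^ k := by
  refine (memFock_iff _).2 ⟨by fun_prop, ?_⟩
  simpa only [norm_pow, ← pow_mul, mul_comm k 2] using integrable_norm_pow_mul_exp k

lemma integral_areaCoord_mul (k : ℕ) {g : ℝ → ℝ} (hg : Measurable g) :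
    ∫ z : ℂ, g (areaCoord z) * (‖z‖ ^ (2 * k) * Real.exp (-areaCoord z))
      = (k.factorial : ℝ) / Real.pi ^ k * ∫ s in Ioi (0 : ℝ), g s * poissonWeight k s := by
  rw [← measurePreserving_areaCoord.map_eq, integral_map
    continuous_areaCoord.measurable.aemeasurable
    (f := fun s => g s * poissonWeight k s) (hg.mul (continuous_poissonWeight k).measurable).aestronglyMeasurable, ← integral_const_mul]
  refine integral_congr_ae (Filter.Eventually.of_forall fun z => ?_)
  have := Real.pi_ne_zero
  simp only [poissonWeight_areaCoord]
  field_simp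

lemma integral_fockPairing_pow {F : ℂ → ℂ} (hF : Differentiable ℂ F) (k : ℕ) {g : ℝ → ℝ}
    (hg : Measurable g)
    (h1 : Integrable (fockPairing (fun z => (g (areaCoord z) : ℂ) * F z) fun z => z ^ k))
    (h2 : Integrable fun z : ℂ =>
      g (areaCoord z) * (‖z‖ ^ (2 * k) * Real.exp (-areaCoord z))) :
    ∫ z, fockPairing (fun z => (g (areaCoord z) : ℂ) * F z) (fun z => z ^ k) z
      = entireCoeff F k * (((k.factorial : ℝ) / Real.pi ^ k *
          ∫ s in Ioi (0 : ℝ), g s * poissonWeight k s : ℝ) : ℂ) := by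
  have hg' : Measurable fun s => g s * Real.exp (-s) := by fun_prop
  have e1 : (fockPairing (fun z => (g (areaCoord z) : ℂ) * F z) fun z => z ^ k)
      = fun z : ℂ => ((g (areaCoord z) * Real.exp (-areaCoord z) : ℝ) : ℂ)
        * (F z * conj z ^ k) := by
    ext z; rw [fockPairing_eq]; push_cast; rw [map_pow]; ring
  have e2 (z : ℂ) : g (areaCoord z) * (‖z‖ ^ (2 * k) * Real.exp (-areaCoord z))
      = g (areaCoord z) * Real.exp (-areaCoord z) * ‖z‖ ^ (2 * k) := by ring
  rw [← integral_areaCoord_mul k hg]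
  rw [e1] at h1 ⊢
  simp only [e2] at h2 ⊢
  exact integral_radial_mul_entire hF k hg' h1 h2.ofReal

lemma norm_fockPairing_pow (G : ℂ → ℂ) (k : ℕ) (z : ℂ) :
    ‖fockPairing G (fun z => z ^ k) z‖ = ‖G z‖ * ‖z‖ ^ k * Real.exp (-areaCoord z) := by
  rw [fockPairing_eq]
  simp only [norm_mul, map_pow, norm_pow, RCLike.norm_conj, Complex.norm_real,
    Real.norm_of_nonneg (Real.exp_pos _).le]

lemma measurable_fockPairing {f g : ℂ → ℂ} (hf : Measurable f) (hg : Measurable g) :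
    Measurable (fockPairing f g) := by
  have hconj : Measurable fun z : ℂ => conj z := Complex.continuous_conj.measurable
  have : fockPairing f g = fun z => f z * conj (g z) * (Real.exp (-areaCoord z) : ℂ) := by
    ext z; exact fockPairing_eq f g z
  rw [this]
  exact (hf.mul (hconj.comp hg)).mul (by fun_prop)

lemma MemFock.integrable_fockPairing_pow {G : ℂ → ℂ} (hG : MemFock G) (k : ℕ) :
    Integrable (fockPairing G fun z => z ^ k) := by
  obtain ⟨hd, hi⟩ := (memFock_iff G).1 hG
  refine (hi.add (integrable_norm_pow_mul_exp k)).mono'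
    (measurable_fockPairing hd.continuous.measurable (by fun_prop)).aestronglyMeasurable
    (Filter.Eventually.of_forall fun z => ?_)
  rw [norm_fockPairing_pow, Pi.add_apply, ← add_mul]
  refine mul_le_mul_of_nonneg_right ?_ (Real.exp_pos _).le
  rw [mul_comm 2 k, pow_mul]
  nlinarith [sq_nonneg (‖G z‖ - ‖z‖ ^ k), sq_nonneg (‖G z‖), sq_nonneg (‖z‖ ^ k)]

/-- The growth bound for `G` is of order `e^{π(|z|+1)²/2}`, so the full Gaussian absorbs it together
with any power. Boundedness is needed to pair against the unbounded part of `h`. -/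
lemma MemFock.exists_norm_fockPairing_pow_le {G : ℂ → ℂ} (hG : MemFock G) (k : ℕ) :
    ∃ B : ℝ, ∀ z, ‖fockPairing G (fun z => z ^ k) z‖ ≤ B := by
  obtain ⟨C, hC0, hC⟩ := hG.norm_sq_le
  refine ⟨Real.sqrt (C * ((2 * k).factorial : ℝ) * Real.exp (2 * Real.pi + 2)), fun z => ?_⟩
  rw [norm_fockPairing_pow]
  refine Real.le_sqrt_of_sq_le ?_
  have h1 : ‖z‖ ^ (2 * k) ≤ ((2 * k).factorial : ℝ) * Real.exp ‖z‖ := by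
    have := Real.pow_div_factorial_le_exp ‖z‖ (norm_nonneg z) (2 * k)
    rw [div_le_iff₀ (by positivity)] at this
    linarith
  calc (‖G z‖ * ‖z‖ ^ k * Real.exp (-areaCoord z)) ^ 2
      = ‖G z‖ ^ 2 * ‖z‖ ^ (2 * k) * Real.exp (-2 * areaCoord z) := by
        rw [mul_pow, mul_pow, ← pow_mul, ← Real.exp_nat_mul, mul_comm k 2]
        push_cast; ring_nf
    _ ≤ (C * Real.exp (Real.pi * (‖z‖ + 1) ^ 2)) * (((2 * k).factorial : ℝ) * Real.exp ‖z‖) *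
          Real.exp (-2 * areaCoord z) := by
        gcongr
        exact hC z
    _ = C * ((2 * k).factorial : ℝ) *
          Real.exp (Real.pi * (‖z‖ + 1) ^ 2 + ‖z‖ + -2 * areaCoord z) := by
        rw [Real.exp_add, Real.exp_add]; ring
    _ ≤ C * ((2 * k).factorial : ℝ) * Real.exp (2 * Real.pi + 2) := by
        refine mul_le_mul_of_nonneg_left (Real.exp_le_exp.2 ?_) (by positivity)
        unfold areaCoord
        -- With `r = |z|` the gap is `π(r-1)² + 2 - r`, which is at least `3r² - 7r + 5 > 0`.
        nlinarith [mul_nonneg (sub_nonneg.2 Real.pi_gt_three.le) (sq_nonneg (‖z‖ - 1)),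
          sq_nonneg (‖z‖ - 3 / 2)]

/-! ### Eigenfunctions of radial Toeplitz operators -/

lemma ToeplitzMapsTo.congr_ae {τ τ' : ℂ → ℝ} (h : τ =ᵐ[volume] τ') {F H : ℂ → ℂ}
    (hF : ToeplitzMapsTo τ F H) : ToeplitzMapsTo τ' F H := by
  refine ⟨hF.1, hF.2.1, fun G hG => ?_⟩
  have hae : fockPairing (fun z => (τ z : ℂ) * F z) G
      =ᵐ[volume] fockPairing (fun z => (τ' z : ℂ) * F z) G := by
    filter_upwards [h] with z hz
    simp only [fockPairing, hz]
  obtain ⟨h1, h2⟩ := hF.2.2 G hG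
  exact ⟨h1.congr hae, by rw [← h2, integral_congr_ae hae]⟩

lemma isToeplitzEigenfunction_congr_ae {τ τ' : ℂ → ℝ} (h : τ =ᵐ[volume] τ') (ν : ℝ)
    (F : ℂ → ℂ) : IsToeplitzEigenfunction τ ν F ↔ IsToeplitzEigenfunction τ' ν F :=
  ⟨fun hF => ⟨hF.1, hF.2.congr_ae h⟩, fun hF => ⟨hF.1, hF.2.congr_ae h.symm⟩⟩

lemma toeplitzEigenvalue_congr_ae {τ τ' : ℂ → ℝ} (h : τ =ᵐ[volume] τ') (n : ℕ) :
    toeplitzEigenvalue τ n = toeplitzEigenvalue τ' n := by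
  simp only [toeplitzEigenvalue, isToeplitzEigenfunction_congr_ae h]

lemma MemFock.const_mul {F : ℂ → ℂ} (hF : MemFock F) (c : ℂ) : MemFock fun z => c * F z := by
  obtain ⟨hd, hi⟩ := (memFock_iff F).1 hF
  refine (memFock_iff _).2 ⟨hd.const_mul c, (hi.const_mul (‖c‖ ^ 2)).congr
    (Filter.Eventually.of_forall fun z => ?_)⟩
  simp only [norm_mul, mul_pow]; ring

lemma integrable_conj {α : Type*} [MeasurableSpace α] {μ : Measure α} {f : α → ℂ}
    (hf : Integrable f μ) : Integrable (fun x => conj (f x)) μ :=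
  (Complex.conjCLE.toContinuousLinearMap).integrable_comp hf

/-- The entire functions `z ^ k` are linearly independent. -/
lemma linearIndependent_complex_pow : LinearIndependent ℂ fun (k : ℕ) (z : ℂ) => z ^ k := by
  rw [linearIndependent_iff']
  intro s g hg k hk
  have hp : (∑ i ∈ s, Polynomial.monomial i (g i) : Polynomial ℂ) = 0 := by
    refine Polynomial.funext fun z => ?_
    have := congrFun hg z
    simpa [Polynomial.eval_finsetSum] using this
  have := congrArg (fun p => Polynomial.coeff p k) hp
  simpa [Polynomial.finsetSum_coeff, Polynomial.coeff_monomial, hk] using this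

section Radial

variable {h : ℝ → ℝ}

lemma IsAdmissibleProfile.integrable_fockPairing_pow (hh : IsAdmissibleProfile h) {G : ℂ → ℂ}
    (hG : MemFock G) (k : ℕ) :
    Integrable (fockPairing (fun z => (h (areaCoord z) : ℂ) * G z) fun z => z ^ k) := by
  have hm := hh.measurable
  obtain ⟨B, hB⟩ := hG.exists_norm_fockPairing_pow_le k
  have h1 := integrable_mul_of_lintegral_sub_ne_top
    (hm.comp continuous_areaCoord.measurable) (fun z => hh.nonneg (areaCoord z))
    (hh.lintegral_areaCoord_sub_ne_top one_pos) (hG.integrable_fockPairing_pow k).norm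
    (B := B) (Filter.Eventually.of_forall fun z => by rw [norm_norm]; exact hB z)
  have hGm : Measurable G := hG.1.continuous.measurable
  refine h1.mono' (measurable_fockPairing (by fun_prop) (by fun_prop)).aestronglyMeasurable
    (Filter.Eventually.of_forall fun z => ?_)
  rw [norm_fockPairing_pow, norm_fockPairing_pow, norm_mul, Complex.norm_real,
    Real.norm_of_nonneg (hh.nonneg _), Function.comp_apply]
  exact le_of_eq (by ring)

lemma IsAdmissibleProfile.integral_fockPairing_pow (hh : IsAdmissibleProfile h) {G : ℂ → ℂ}
    (hG : MemFock G) (k : ℕ) :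
    ∫ z, fockPairing (fun z => (h (areaCoord z) : ℂ) * G z) (fun z => z ^ k) z
      = entireCoeff G k * ((k.factorial : ℝ) / Real.pi ^ k : ℝ) * (profileCoeff h k : ℂ) := by
  rw [_root_.integral_fockPairing_pow hG.1 k hh.measurable
    (hh.integrable_fockPairing_pow hG k), profileCoeff]
  · push_cast; ring
  · have h1 : Integrable fun z : ℂ => h (areaCoord z) * poissonWeight k (areaCoord z) :=
      measurePreserving_areaCoord.integrable_comp_of_integrable (hh.integrableOn k)
    refine (h1.const_mul ((k.factorial : ℝ) / Real.pi ^ k)).congr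
      (Filter.Eventually.of_forall fun z => ?_)
    have := Real.pi_ne_zero
    simp only [poissonWeight_areaCoord]
    field_simp

lemma MemFock.integral_fockPairing_pow {G : ℂ → ℂ} (hG : MemFock G) (k : ℕ) :
    ∫ z, fockPairing G (fun z => z ^ k) z
      = entireCoeff G k * ((k.factorial : ℝ) / Real.pi ^ k : ℝ) := by
  have h1 := _root_.integral_fockPairing_pow hG.1 k (g := fun _ => 1) measurable_const
    (by simpa using hG.integrable_fockPairing_pow k)
    (by simpa using integrable_norm_pow_mul_exp k)
  simpa only [Complex.ofReal_one, one_mul, integral_Ioi_poissonWeight, mul_one] using h1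

lemma factorial_div_pi_pow_ne_zero (k : ℕ) :
    (((k.factorial : ℝ) / Real.pi ^ k : ℝ) : ℂ) ≠ 0 := by
  have : (k.factorial : ℝ) / Real.pi ^ k ≠ 0 := by positivity
  exact_mod_cast this

lemma fockPairing_const_mul_left (c : ℂ) (f g : ℂ → ℂ) (z : ℂ) :
    fockPairing (fun z => c * f z) g z = c * fockPairing f g z := by
  simp only [fockPairing]; ring

/-- Only monomials with the right eigenvalue occur in an eigenfunction. -/
lemma IsAdmissibleProfile.profileCoeff_eq_of_entireCoeff_ne_zero (hh : IsAdmissibleProfile h)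
    {ν : ℝ} {F : ℂ → ℂ} (hF : IsToeplitzEigenfunction (fun z => h (areaCoord z)) ν F) {k : ℕ}
    (hk : entireCoeff F k ≠ 0) : profileCoeff h k = ν := by
  have h1 := (hF.2.2.2 _ (memFock_pow k)).2
  simp only [fockPairing_const_mul_left (ν : ℂ)] at h1
  rw [hh.integral_fockPairing_pow hF.2.1 k, integral_const_mul,
    hF.2.1.integral_fockPairing_pow k, mul_comm (ν : ℂ)] at h1
  exact_mod_cast mul_left_cancel₀ (mul_ne_zero hk (factorial_div_pi_pow_ne_zero k)) h1

/-- Monomials are eigenfunctions of Toeplitz operators with radial symbols. -/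
lemma IsAdmissibleProfile.isToeplitzEigenfunction_pow (hh : IsAdmissibleProfile h) (k : ℕ)
    {c : ℂ} (hc : c ≠ 0) :
    IsToeplitzEigenfunction (fun z => h (areaCoord z)) (profileCoeff h k) fun z => c * z ^ k := by
  have hmem := (memFock_pow k).const_mul c
  -- As `h` is real, each pairing of `z^k` with `G` is the conjugate of one of `G` with `z^k`, so
  -- the coefficient formulas apply.
  refine ⟨fun h0 => hc (by simpa using congrFun h0 1), hmem, hmem.const_mul _, fun G hG => ?_⟩
  have e1 : fockPairing (fun z => ((h (areaCoord z) : ℝ) : ℂ) * (c * z ^ k)) G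
      = fun z => c * conj (fockPairing (fun z => (h (areaCoord z) : ℂ) * G z)
          (fun z => z ^ k) z) := by
    ext z
    simp only [fockPairing, map_mul, Complex.conj_ofReal, Complex.conj_conj]; ring
  have e2 : fockPairing (fun z => (profileCoeff h k : ℂ) * (c * z ^ k)) G
      = fun z => profileCoeff h k * c * conj (fockPairing G (fun z => z ^ k) z) := by
    ext z
    simp only [fockPairing, map_mul, Complex.conj_ofReal, Complex.conj_conj]; ring
  rw [e1, e2]
  refine ⟨(integrable_conj (hh.integrable_fockPairing_pow hG k)).const_mul c, ?_⟩
  rw [integral_const_mul, integral_const_mul, integral_conj, integral_conj,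
    hh.integral_fockPairing_pow hG k, hG.integral_fockPairing_pow k]
  simp only [map_mul, Complex.conj_ofReal]
  ring

/-- Eigenfunctions with eigenvalue at least `t` contain only monomials with coefficient at least
`t`. Hence `n + 1` independent ones exist exactly when that many such monomials do, and the
admissible thresholds form a half-line. -/
lemma IsAdmissibleProfile.toeplitzEigenvalue_succ (hh : IsAdmissibleProfile h) {e : ℕ → ℕ}
    (he : IsDecreasingEnumeration (profileCoeff h) e) (n : ℕ) :
    toeplitzEigenvalue (fun z => h (areaCoord z)) (n + 1) = profileCoeff h (e n) := by
  classical
  have hset : {t : ℝ | ∃ F : Fin (n + 1) → ℂ → ℂ, LinearIndependent ℂ F ∧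
      ∀ i, ∃ ν : ℝ, t ≤ ν ∧ IsToeplitzEigenfunction (fun z => h (areaCoord z)) ν (F i)}
      = Iic (profileCoeff h (e n)) := by
    ext t
    rw [mem_ofPred_eq, mem_Iic]
    constructor
    · rintro ⟨F, hF, hev⟩
      rw [← he.le_encard_iff]
      -- The infinite case makes the counting inequality trivial; it occurs for `t ≤ 0`.
      by_cases hS : {k | t ≤ profileCoeff h k}.Finite
      · have hspan : range F ≤ Submodule.span ℂ
            ((hS.toFinset.image fun (k : ℕ) (z : ℂ) => z ^ k : Finset (ℂ → ℂ)) : Set (ℂ → ℂ)) := by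
          rintro _ ⟨i, rfl⟩
          obtain ⟨ν, hν, hFi⟩ := hev i
          have hsum : F i = ∑ k ∈ hS.toFinset, entireCoeff (F i) k • fun z : ℂ => z ^ k := by
            ext z
            have h1 := hasSum_entireCoeff hFi.2.1.1 z
            have h2 := hasSum_sum_of_ne_finset_zero (L := .unconditional ℕ) (f := fun k => entireCoeff (F i) k * z ^ k)
              (s := hS.toFinset) fun k hk => by
                by_contra hne
                have := hh.profileCoeff_eq_of_entireCoeff_ne_zero hFi (left_ne_zero_of_mul hne)
                exact hk (by simp [this, hν])
            rw [h1.unique h2]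
            simp
          rw [hsum]
          refine Submodule.sum_mem _ fun k hk => Submodule.smul_mem _ _
            (Submodule.subset_span ?_)
          exact Finset.mem_coe.2 (Finset.mem_image_of_mem _ hk)
        have hcard := linearIndependent_le_span' F hF _ hspan
        simp only [Finset.coe_sort_coe, Fintype.card_coe, Cardinal.mk_fin] at hcard
        have h3 : n + 1 ≤ hS.toFinset.card :=
          (Nat.cast_le.1 hcard).trans Finset.card_image_le
        rw [hS.encard_eq_coe_toFinset_card]
        exact_mod_cast h3
      · rw [Set.encard_eq_top_iff.2 hS]; exact le_top
    · intro ht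
      refine ⟨fun i z => z ^ e i, linearIndependent_complex_pow.comp (fun i : Fin (n + 1) => e i)
        (he.1.comp Fin.val_injective), fun i => ⟨profileCoeff h (e i), ht.trans ?_, ?_⟩⟩
      · exact he.2 i (e n) fun l hl h => by
          have := he.1 h
          have := i.2
          omega
      · simpa using hh.isToeplitzEigenfunction_pow (e i) one_ne_zero
  rw [toeplitzEigenvalue, hset, csSup_Iic]

lemma IsAdmissibleProfile.sum_toeplitzEigenvalue (hh : IsAdmissibleProfile h) {e : ℕ → ℕ}
    (he : IsDecreasingEnumeration (profileCoeff h) e) (n : ℕ) :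
    ∑ k ∈ Finset.Icc 1 n, toeplitzEigenvalue (fun z => h (areaCoord z)) k
      = ∑ k ∈ (Finset.range n).image e, profileCoeff h k := by
  rw [Finset.sum_image fun i _ j _ hij => he.1 hij, Finset.range_eq_Ico,
    Finset.sum_congr rfl fun i _ => (hh.toeplitzEigenvalue_succ he i).symm,
    Finset.sum_Ico_add' (fun k => toeplitzEigenvalue (fun z => h (areaCoord z)) k) 0 n 1]
  rfl

/-- Eigenfunctions for a simple eigenvalue are multiples of a monomial. -/
lemma IsAdmissibleProfile.isToeplitzEigenfunction_iff (hh : IsAdmissibleProfile h) {k : ℕ}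
    (hk : ∀ j, profileCoeff h j = profileCoeff h k → j = k) (F : ℂ → ℂ) :
    IsToeplitzEigenfunction (fun z => h (areaCoord z)) (profileCoeff h k) F ↔
      ∃ c : ℂ, c ≠ 0 ∧ F = c • fockMonomial k := by
  have hC : ((Real.pi ^ ((k : ℝ) / 2) / Real.sqrt (k.factorial : ℝ) : ℝ) : ℂ) ≠ 0 := by
    have : 0 < Real.pi ^ ((k : ℝ) / 2) / Real.sqrt (k.factorial : ℝ) := by
      have := Real.pi_pos
      positivity
    exact_mod_cast this.ne'
  set C := ((Real.pi ^ ((k : ℝ) / 2) / Real.sqrt (k.factorial : ℝ) : ℝ) : ℂ) with hCdef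
  have hmono : fockMonomial k = fun z => C * z ^ k := rfl
  constructor
  · intro hF
    have hFz : F = fun z => entireCoeff F k * z ^ k := by
      ext z
      refine (hasSum_entireCoeff hF.2.1.1 z).unique (hasSum_single k fun j hj => ?_)
      by_contra hne
      exact hj (hk j (hh.profileCoeff_eq_of_entireCoeff_ne_zero hF (left_ne_zero_of_mul hne)))
    have hne : entireCoeff F k ≠ 0 := fun h0 => hF.1 (by rw [hFz, h0]; ext; simp)
    refine ⟨entireCoeff F k / C, div_ne_zero hne hC, ?_⟩
    rw [hmono]
    nth_rewrite 1 [hFz]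
    ext z
    simp only [Pi.smul_apply, smul_eq_mul]
    field_simp
  · rintro ⟨c, hc, rfl⟩
    convert! hh.isToeplitzEigenfunction_pow k (mul_ne_zero hc hC) using 1
    ext z
    simp only [hmono, Pi.smul_apply, smul_eq_mul]
    ring

end Radial

/-! ### Measurable profiles of radial symbols -/

lemma measurable_polarCoord_symm : Measurable fun p : ℝ × ℝ => Complex.polarCoord.symm p := by
  simp only [Complex.polarCoord_symm_apply]; fun_prop

lemma measurableSet_polarCoord_target : MeasurableSet polarCoord.target := by
  rw [polarCoord_target]; exact measurableSet_Ioi.prod measurableSet_Ioo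

/-- The Jacobian `r` is strictly positive on the polar domain, so null sets correspond. -/
lemma volume_eq_zero_iff_ae_polarCoord {N : Set ℂ} (hN : MeasurableSet N) :
    volume N = 0 ↔
      ∀ᵐ p ∂volume.restrict polarCoord.target, Complex.polarCoord.symm p ∉ N := by
  rw [← lintegral_indicator_one hN, ← Complex.lintegral_comp_polarCoord_symm,
    lintegral_eq_zero_iff]
  · constructor
    · intro h
      filter_upwards [h, ae_restrict_mem measurableSet_polarCoord_target] with p hp hpt hpN
      have hp1 : 0 < p.1 := by rw [polarCoord_target] at hpt; exact hpt.1
      rw [indicator_of_mem hpN] at hp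
      simp only [Pi.one_apply, smul_eq_mul, mul_one, Pi.zero_apply, ENNReal.ofReal_eq_zero] at hp
      linarith
    · intro h
      filter_upwards [h] with p hp
      rw [indicator_of_notMem hp]; simp
  · exact (ENNReal.measurable_ofReal.comp measurable_fst).smul
      ((measurable_one.indicator hN).comp measurable_polarCoord_symm)

lemma ae_norm_of_ae {P : ℝ → Prop} (h : ∀ᵐ r : ℝ, 0 < r → P r) : ∀ᵐ z : ℂ, P ‖z‖ := by
  obtain ⟨M, hM, hMm, hM0⟩ := exists_measurable_superset_of_null (ae_iff.1 h)
  have h1 : volume {z : ℂ | ‖z‖ ∈ M} = 0 := by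
    refine (volume_eq_zero_iff_ae_polarCoord (measurable_norm hMm)).2 ?_
    have h2 : ∀ᵐ p : ℝ × ℝ, p.1 ∉ M := by
      rw [Measure.volume_eq_prod]
      exact Measure.quasiMeasurePreserving_fst.ae (measure_eq_zero_iff_ae_notMem.1 hM0)
    filter_upwards [ae_restrict_of_ae h2, ae_restrict_mem measurableSet_polarCoord_target]
      with p hp hpt
    have hp1 : 0 < p.1 := by rw [polarCoord_target] at hpt; exact hpt.1
    change ‖Complex.polarCoord.symm p‖ ∉ M
    rwa [Complex.norm_polarCoord_symm, abs_of_pos hp1]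
  have h3 : ∀ᵐ z : ℂ, z ≠ 0 := by simp [ae_iff]
  filter_upwards [measure_eq_zero_iff_ae_notMem.1 h1, h3] with z hz hz0
  by_contra hcon
  exact hz (hM fun hP => hcon (hP (norm_pos_iff.2 hz0)))

/-- A measurable function that is almost everywhere radial has a measurable radial profile. -/
lemma exists_measurable_radial_profile {τ : ℂ → ℝ} (hτ : Measurable τ) {f : ℝ → ℝ}
    (hf : ∀ᵐ z : ℂ, τ z = f ‖z‖) : ∃ g : ℝ → ℝ, Measurable g ∧ ∀ᵐ z : ℂ, τ z = g ‖z‖ := by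
  obtain ⟨N, hN, hNm, hN0⟩ := exists_measurable_superset_of_null (ae_iff.1 hf)
  have h1 := (volume_eq_zero_iff_ae_polarCoord hNm).1 hN0
  rw [polarCoord_target, Measure.volume_eq_prod, ← Measure.prod_restrict] at h1
  -- The given `f` may be nonmeasurable. By Fubini almost every ray meets the exceptional set in a
  -- null set of radii, and `τ` restricted to one such ray is the measurable profile.
  have h2 := Measure.ae_ae_of_ae_prod h1
  rw [Measure.ae_ae_comm (p := fun r θ => Complex.polarCoord.symm (r, θ) ∉ N)
    (measurable_polarCoord_symm hNm.compl)] at h2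
  have hne : Filter.NeBot (ae (volume.restrict (Ioo (-Real.pi) Real.pi))) := by
    rw [ae_neBot, Ne, Measure.restrict_eq_zero, Real.volume_Ioo]
    simp [Real.pi_pos]
  obtain ⟨θ, hθ⟩ := h2.exists
  rw [ae_restrict_iff' measurableSet_Ioi] at hθ
  refine ⟨fun r => τ (Complex.polarCoord.symm (r, θ)),
    hτ.comp (measurable_polarCoord_symm.comp (measurable_id.prodMk measurable_const)), ?_⟩
  have h3 : ∀ᵐ r : ℝ, 0 < r → τ (Complex.polarCoord.symm (r, θ)) = f r := by
    filter_upwards [hθ] with r hr hr0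
    have h4 : τ (Complex.polarCoord.symm (r, θ)) = f ‖Complex.polarCoord.symm (r, θ)‖ := by
      by_contra hcon
      exact hr hr0 (hN hcon)
    rwa [Complex.norm_polarCoord_symm, abs_of_pos hr0] at h4
  filter_upwards [hf, ae_norm_of_ae h3] with z hz1 hz2
  rw [hz1, hz2]

lemma lintegral_ofReal_sub_ne_top {α : Type*} [MeasurableSpace α] {μ : Measure α} {p : ℝ≥0∞}
    (hp_one : 1 ≤ p) (hp_top : p ≠ ∞) {σ : α → ℝ} (hσ : MemLp σ p μ) {ε : ℝ} (hε : 0 < ε) :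
    ∫⁻ x, ENNReal.ofReal (σ x - ε) ∂μ ≠ ∞ := by
  have hp0 : p ≠ 0 := (zero_lt_one.trans_le hp_one).ne'
  have hq : 1 ≤ p.toReal := by
    rw [← ENNReal.toReal_one]; exact ENNReal.toReal_mono hp_top hp_one
  have h1 := lintegral_rpow_enorm_lt_top_of_eLpNorm_lt_top hp0 hp_top hσ.2
  -- Where `σ > ε`, `σ = σ^{1-p} σ^p ≤ ε^{1-p} σ^p`, because `1 - p ≤ 0`.
  refine ne_of_lt (lt_of_le_of_lt (lintegral_mono (g := fun x =>
    ENNReal.ofReal (ε ^ (1 - p.toReal)) * ‖σ x‖ₑ ^ p.toReal) fun x => ?_) ?_)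
  · rcases le_or_gt (σ x) ε with hx | hx
    · rw [ENNReal.ofReal_of_nonpos (by linarith)]; exact bot_le
    · have hx0 : 0 < σ x := hε.trans hx
      simp only
      rw [Real.enorm_of_nonneg hx0.le, ENNReal.ofReal_rpow_of_pos hx0,
        ← ENNReal.ofReal_mul (by positivity)]
      refine ENNReal.ofReal_le_ofReal ?_
      calc σ x - ε ≤ σ x := by linarith
        _ = σ x ^ (1 - p.toReal) * σ x ^ p.toReal := by
          rw [← Real.rpow_add hx0]; simp
        _ ≤ ε ^ (1 - p.toReal) * σ x ^ p.toReal := by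
          refine mul_le_mul_of_nonneg_right ?_ (by positivity)
          exact Real.rpow_le_rpow_of_nonpos hε hx.le (by linarith)
  · rw [lintegral_const_mul' _ _ ENNReal.ofReal_ne_top]
    exact ENNReal.mul_lt_top ENNReal.ofReal_lt_top h1

/-- Nonnegative radial symbols in `L^p` have admissible profiles. -/
lemma exists_isAdmissibleProfile {p : ℝ≥0∞} (hp_one : 1 ≤ p) (hp_top : p ≠ ∞)
    {σ : ℂ → ℝ} (hσ : MemLp σ p volume) (hσ_nonneg : ∀ᵐ z : ℂ, 0 ≤ σ z)
    (hσ_radial : IsRadialSymbol σ) :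
    ∃ h, IsAdmissibleProfile h ∧ σ =ᵐ[volume] fun z => h (areaCoord z) := by
  obtain ⟨f, hf⟩ := hσ_radial
  have hmk := hσ.1.ae_eq_mk
  obtain ⟨g, hg, hgz⟩ := exists_measurable_radial_profile hσ.1.stronglyMeasurable_mk.measurable
    (f := f) (by filter_upwards [hf, hmk] with z h1 h2; rw [← h2, h1])
  have hae : σ =ᵐ[volume] fun z => max (g (Real.sqrt (areaCoord z / Real.pi))) 0 := by
    filter_upwards [hmk, hgz, hσ_nonneg] with z h1 h2 h3
    have hs : Real.sqrt (areaCoord z / Real.pi) = ‖z‖ := by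
      rw [areaCoord, mul_div_cancel_left₀ _ Real.pi_ne_zero, Real.sqrt_sq (norm_nonneg z)]
    rw [hs, ← h2, ← h1, max_eq_left h3]
  have hm : Measurable fun s => max (g (Real.sqrt (s / Real.pi))) 0 := by fun_prop
  refine ⟨fun s => max (g (Real.sqrt (s / Real.pi))) 0, ⟨hm, fun s => le_max_right _ _,
    fun ε hε => ?_⟩, hae⟩
  rw [← measurePreserving_areaCoord.lintegral_comp
    (f := fun s => ENNReal.ofReal (max (g (Real.sqrt (s / Real.pi))) 0 - ε)) (by fun_prop)]
  rw [lintegral_congr_ae (g := fun z => ENNReal.ofReal (σ z - ε))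
    (by filter_upwards [hae] with z hz; rw [hz])]
  exact lintegral_ofReal_sub_ne_top hp_one hp_top hσ hε

/-! ### Layer-cake formulas and the rearranged profile -/

/-- The superlevel set of a profile on the open half-line. -/
def profileLevelSet (h : ℝ → ℝ) (t : ℝ) : Set ℝ := {s | 0 < s ∧ t < h s}

/-- The measure of the superlevel set of a profile. -/
noncomputable def profileDistribution (h : ℝ → ℝ) (t : ℝ) : ℝ :=
  volume.real (profileLevelSet h t)

/-- The decreasing rearrangement of a profile. -/
noncomputable def rearrangedProfile (h : ℝ → ℝ) (s : ℝ) : ℝ :=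
  volume.real {t : ℝ | 0 < t ∧ s < profileDistribution h t}

lemma profileDistribution_nonneg (h : ℝ → ℝ) (t : ℝ) : 0 ≤ profileDistribution h t :=
  measureReal_nonneg

/-- Fubini on a planar region whose slice over `s` has length `u(s)`. It serves both the region
under the graph of `h` and the rearranged region. -/
lemma profileCoeff_eq_integral_slices {u : ℝ → ℝ} (hu : IsAdmissibleProfile u)
    {E : Set (ℝ × ℝ)} (hE : MeasurableSet E) (hsub : E ⊆ Ioi 0 ×ˢ Ioi 0)
    (hslice : ∀ s, 0 < s → volume {t | (t, s) ∈ E} = ENNReal.ofReal (u s)) (k : ℕ) :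
    IntegrableOn (fun t => ∫ s in {s | (t, s) ∈ E}, poissonWeight k s) (Ioi 0) ∧
      profileCoeff u k = ∫ t in Ioi 0, ∫ s in {s | (t, s) ∈ E}, poissonWeight k s := by
  set F : ℝ × ℝ → ℝ := E.indicator fun p => poissonWeight k p.2 with hFdef
  have hFm : Measurable F :=
    Measurable.indicator ((continuous_poissonWeight k).measurable.comp measurable_snd) hE
  have hms (t : ℝ) : MeasurableSet {s | (t, s) ∈ E} := measurable_prodMk_left hE
  have hmt (s : ℝ) : MeasurableSet {t | (t, s) ∈ E} := measurable_prodMk_right hE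
  have hFt (t : ℝ) : (fun s => F (t, s)) = {s | (t, s) ∈ E}.indicator (poissonWeight k) := by
    ext s; simp only [hFdef, indicator]; rfl
  have hFs (s : ℝ) : (fun t => F (t, s))
      = {t | (t, s) ∈ E}.indicator fun _ => poissonWeight k s := by
    ext t; simp only [hFdef, indicator]; rfl
  have hempty {s : ℝ} (hs : ¬ 0 < s) : {t | (t, s) ∈ E} = ∅ :=
    eq_empty_of_forall_notMem fun t ht => hs (hsub ht).2
  have hFnn (p : ℝ × ℝ) : 0 ≤ F p :=
    indicator_nonneg (fun p hp => poissonWeight_nonneg k (le_of_lt (hsub hp).2)) p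
  have hint (s : ℝ) : ∫ t, F (t, s)
      = (Ioi (0 : ℝ)).indicator (fun s => u s * poissonWeight k s) s := by
    rw [hFs, integral_indicator (hmt s), setIntegral_const, smul_eq_mul]
    by_cases hs : 0 < s
    · rw [indicator_of_mem (mem_Ioi.2 hs), measureReal_def, hslice s hs,
        ENNReal.toReal_ofReal (hu.nonneg s)]
    · rw [indicator_of_notMem (by simpa using hs), hempty hs]; simp
  have hFi : Integrable F (volume.prod volume) := by
    refine (integrable_prod_iff' hFm.aestronglyMeasurable).2
      ⟨Filter.Eventually.of_forall fun s => ?_, ?_⟩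
    · rw [hFs, integrable_indicator_iff (hmt s)]
      refine integrableOn_const ?_
      by_cases hs : 0 < s
      · rw [hslice s hs]; exact ENNReal.ofReal_ne_top
      · rw [hempty hs]; simp
    · simp only [Real.norm_of_nonneg (hFnn _), hint]
      exact (hu.integrableOn k).integrable_indicator measurableSet_Ioi
  have hleft (t : ℝ) : ∫ s, F (t, s) = ∫ s in {s | (t, s) ∈ E}, poissonWeight k s := by
    rw [hFt, integral_indicator (hms t)]
  have hsupp : ∀ t, t ∉ Ioi (0 : ℝ) → ∫ s in {s | (t, s) ∈ E}, poissonWeight k s = 0 := by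
    intro t ht
    rw [eq_empty_of_forall_notMem (s := {s | (t, s) ∈ E}) fun s hs => ht (hsub hs).1]
    simp
  constructor
  · have := hFi.integral_prod_left
    simp only [hleft] at this
    exact this.integrableOn
  · rw [setIntegral_eq_integral_of_forall_compl_eq_zero hsupp]
    simp only [← hleft]
    rw [integral_integral_swap (f := fun t s => F (t, s)) hFi]
    simp only [hint]
    rw [integral_indicator measurableSet_Ioi, profileCoeff]

namespace IsAdmissibleProfile

variable {h : ℝ → ℝ}

lemma measurableSet_levelSet (hh : IsAdmissibleProfile h) (t : ℝ) :
    MeasurableSet (profileLevelSet h t) :=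
  measurableSet_Ioi.inter (measurableSet_lt measurable_const hh.measurable)

/-- Markov's inequality for `(h - ε)_+`. -/
lemma mul_volume_levelSet_le (hh : IsAdmissibleProfile h) (ε t : ℝ) :
    ENNReal.ofReal (t - ε) * volume (profileLevelSet h t)
      ≤ ∫⁻ s in Ioi 0, ENNReal.ofReal (h s - ε) := by
  have hm := hh.measurable
  refine le_trans ?_ (mul_meas_ge_le_lintegral (μ := volume.restrict (Ioi 0))
    (f := fun s => ENNReal.ofReal (h s - ε)) (by fun_prop) (ENNReal.ofReal (t - ε)))
  refine mul_le_mul' le_rfl ?_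
  rw [Measure.restrict_apply' measurableSet_Ioi]
  refine measure_mono fun s hs => ⟨?_, hs.1⟩
  have := hs.2
  exact ENNReal.ofReal_le_ofReal (by linarith)

lemma volume_levelSet_ne_top (hh : IsAdmissibleProfile h) {t : ℝ} (ht : 0 < t) :
    volume (profileLevelSet h t) ≠ ∞ := by
  intro htop
  have h1 := hh.mul_volume_levelSet_le (t / 2) t
  rw [htop, ENNReal.mul_top (by simpa using by linarith)] at h1
  exact hh.lintegral_sub_ne_top (t / 2) (by positivity) (top_le_iff.1 h1)

lemma ofReal_profileDistribution (hh : IsAdmissibleProfile h) {t : ℝ} (ht : 0 < t) :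
    ENNReal.ofReal (profileDistribution h t) = volume (profileLevelSet h t) :=
  ENNReal.ofReal_toReal (hh.volume_levelSet_ne_top ht)

lemma profileDistribution_anti (hh : IsAdmissibleProfile h) {t t' : ℝ} (ht : 0 < t)
    (htt' : t ≤ t') : profileDistribution h t' ≤ profileDistribution h t :=
  measureReal_mono (fun _ hs => ⟨hs.1, htt'.trans_lt hs.2⟩) (hh.volume_levelSet_ne_top ht)

lemma _root_.measurable_profileDistribution (h : ℝ → ℝ) : Measurable (profileDistribution h) := by
  have : Antitone fun t => volume (profileLevelSet h t) :=
    fun t t' htt' => measure_mono fun _ hs => ⟨hs.1, htt'.trans_lt hs.2⟩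
  exact this.measurable.ennreal_toReal

lemma _root_.measurableSet_rearrangedRegion (h : ℝ → ℝ) {ε : ℝ} :
    MeasurableSet {p : ℝ × ℝ | ε < p.1 ∧ 0 < p.2 ∧ p.2 < profileDistribution h p.1} :=
  (measurableSet_lt measurable_const measurable_fst).inter
    ((measurableSet_lt measurable_const measurable_snd).inter
      (measurableSet_lt measurable_snd
        ((measurable_profileDistribution h).comp measurable_fst)))

lemma measurableSet_levelRegion (hh : IsAdmissibleProfile h) {ε : ℝ} :
    MeasurableSet {p : ℝ × ℝ | ε < p.1 ∧ 0 < p.2 ∧ p.1 < h p.2} :=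
  (measurableSet_lt measurable_const measurable_fst).inter
    ((measurableSet_lt measurable_const measurable_snd).inter
      (measurableSet_lt measurable_fst (hh.measurable.comp measurable_snd)))

lemma volume_rearranged_ne_top (hh : IsAdmissibleProfile h) {s : ℝ} (hs : 0 < s) :
    volume {t : ℝ | 0 < t ∧ s < profileDistribution h t} ≠ ∞ := by
  set C := (∫⁻ s in Ioi 0, ENNReal.ofReal (h s - 1)).toReal with hC
  have hC0 : 0 ≤ C := ENNReal.toReal_nonneg
  -- For `t > 1`, Markov's inequality gives `(t - 1) μ(t) ≤ C`, so `s < μ(t)` forces `t ≤ 1 + C /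
  -- s`.
  suffices hsub : {t : ℝ | 0 < t ∧ s < profileDistribution h t} ⊆ Ioc 0 (1 + C / s) from
    measure_ne_top_of_subset hsub (by simp)
  refine fun t ht => ⟨ht.1, ?_⟩
  by_contra! hcon
  have ht1 : 1 < t := lt_of_le_of_lt (le_add_of_nonneg_right (by positivity)) hcon
  have h1 := ENNReal.toReal_mono (hh.lintegral_sub_ne_top 1 one_pos)
    (hh.mul_volume_levelSet_le 1 t)
  rw [ENNReal.toReal_mul, ENNReal.toReal_ofReal (by linarith), ← hC] at h1
  have h2 : s < profileDistribution h t := ht.2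
  have h3 : (t - 1) * s ≤ (t - 1) * profileDistribution h t := by
    have : 0 ≤ t - 1 := by linarith
    gcongr
  have h4 : C < (t - 1) * s := by
    have : C / s < t - 1 := by linarith
    rwa [div_lt_iff₀ hs] at this
  have h5 : (t - 1) * profileDistribution h t ≤ C := h1
  linarith

lemma ofReal_rearrangedProfile (hh : IsAdmissibleProfile h) {s : ℝ} (hs : 0 < s) :
    ENNReal.ofReal (rearrangedProfile h s)
      = volume {t : ℝ | 0 < t ∧ s < profileDistribution h t} :=
  ENNReal.ofReal_toReal (hh.volume_rearranged_ne_top hs)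

/-- The two planar regions have slices of the same length `μ(t)` at each level `t > ε`, so Tonelli
equates their areas. -/
lemma lintegral_rearrangedRegion (hh : IsAdmissibleProfile h) {ε : ℝ} (hε : 0 < ε) :
    ∫⁻ s in Ioi 0, volume {t : ℝ | ε < t ∧ s < profileDistribution h t}
      = ∫⁻ s in Ioi 0, ENNReal.ofReal (h s - ε) := by
  have hA := Measure.prod_apply_symm (μ := (volume : Measure ℝ)) (ν := (volume : Measure ℝ))
    (measurableSet_rearrangedRegion h (ε := ε))
  rw [Measure.prod_apply (measurableSet_rearrangedRegion h)] at hA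
  have hB := Measure.prod_apply_symm (μ := (volume : Measure ℝ)) (ν := (volume : Measure ℝ))
    (hh.measurableSet_levelRegion (ε := ε))
  rw [Measure.prod_apply hh.measurableSet_levelRegion] at hB
  have hAB : ∫⁻ t, volume (Prod.mk t ⁻¹'
        {p : ℝ × ℝ | ε < p.1 ∧ 0 < p.2 ∧ p.2 < profileDistribution h p.1})
      = ∫⁻ t, volume (Prod.mk t ⁻¹' {p : ℝ × ℝ | ε < p.1 ∧ 0 < p.2 ∧ p.1 < h p.2}) := by
    refine lintegral_congr fun t => ?_
    by_cases ht : ε < t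
    · have e1 : Prod.mk t ⁻¹' {p : ℝ × ℝ | ε < p.1 ∧ 0 < p.2 ∧ p.2 < profileDistribution h p.1}
          = Ioo 0 (profileDistribution h t) := by
        ext s; exact and_iff_right ht
      have e2 : Prod.mk t ⁻¹' {p : ℝ × ℝ | ε < p.1 ∧ 0 < p.2 ∧ p.1 < h p.2}
          = profileLevelSet h t := by
        ext s; exact and_iff_right ht
      rw [e1, e2, Real.volume_Ioo, sub_zero, hh.ofReal_profileDistribution (hε.trans ht)]
    · have e1 : Prod.mk t ⁻¹' {p : ℝ × ℝ | ε < p.1 ∧ 0 < p.2 ∧ p.2 < profileDistribution h p.1}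
          = ∅ := eq_empty_of_forall_notMem fun s hs => ht hs.1
      have e2 : Prod.mk t ⁻¹' {p : ℝ × ℝ | ε < p.1 ∧ 0 < p.2 ∧ p.1 < h p.2} = ∅ :=
        eq_empty_of_forall_notMem fun s hs => ht hs.1
      rw [e1, e2]
  rw [hA, hB] at hAB
  rw [← lintegral_indicator measurableSet_Ioi, ← lintegral_indicator measurableSet_Ioi]
  convert! hAB using 1
  · refine lintegral_congr fun s => ?_
    by_cases hs : 0 < s
    · rw [indicator_of_mem (mem_Ioi.2 hs)]
      congr 1
      ext t; exact and_congr_right fun _ => (and_iff_right hs).symm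
    · rw [indicator_of_notMem (by simpa using hs), eq_empty_of_forall_notMem
        (s := (fun x => (x, s)) ⁻¹' _) fun t ht => hs ht.2.1, measure_empty]
  · refine lintegral_congr fun s => ?_
    by_cases hs : 0 < s
    · rw [indicator_of_mem (mem_Ioi.2 hs)]
      have e1 : (fun x => (x, s)) ⁻¹' {p : ℝ × ℝ | ε < p.1 ∧ 0 < p.2 ∧ p.1 < h p.2}
          = Ioo ε (h s) := by
        ext t; exact and_congr_right fun _ => and_iff_right hs
      rw [e1, Real.volume_Ioo]
    · rw [indicator_of_notMem (by simpa using hs), eq_empty_of_forall_notMem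
        (s := (fun x => (x, s)) ⁻¹' _) fun t ht => hs ht.2.1, measure_empty]

/-- The rearranged profile of an admissible profile is admissible. -/
lemma rearranged (hh : IsAdmissibleProfile h) : IsAdmissibleProfile (rearrangedProfile h) where
  measurable := by
    have : MeasurableSet {p : ℝ × ℝ | 0 < p.2 ∧ p.1 < profileDistribution h p.2} :=
      (measurableSet_lt measurable_const measurable_snd).inter
        (measurableSet_lt measurable_fst
          ((measurable_profileDistribution h).comp measurable_snd))
    exact (measurable_measure_prodMk_left this).ennreal_toReal
  nonneg s := measureReal_nonneg
  lintegral_sub_ne_top ε hε := by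
    refine ne_top_of_le_ne_top (hh.lintegral_sub_ne_top ε hε) ?_
    rw [← hh.lintegral_rearrangedRegion hε]
    refine setLIntegral_mono' measurableSet_Ioi fun s hs => ?_
    rw [ENNReal.ofReal_sub _ hε.le, hh.ofReal_rearrangedProfile hs, tsub_le_iff_right]
    -- Discarding the levels `0 < t ≤ ε` costs at most `ε`, which absorbs the subtraction.
    calc volume {t : ℝ | 0 < t ∧ s < profileDistribution h t}
        ≤ volume ({t : ℝ | ε < t ∧ s < profileDistribution h t} ∪ Ioc 0 ε) := by
          refine measure_mono fun t ht => ?_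
          rcases lt_or_ge ε t with h1 | h1
          · exact Or.inl ⟨h1, ht.2⟩
          · exact Or.inr ⟨ht.1, h1⟩
      _ ≤ volume {t : ℝ | ε < t ∧ s < profileDistribution h t} + volume (Ioc 0 ε) :=
          measure_union_le _ _
      _ = _ := by rw [Real.volume_Ioc, sub_zero]

lemma profileCoeff_eq_integral_levelSet (hh : IsAdmissibleProfile h) (k : ℕ) :
    IntegrableOn (fun t => ∫ s in profileLevelSet h t, poissonWeight k s) (Ioi 0) ∧
      profileCoeff h k = ∫ t in Ioi 0, ∫ s in profileLevelSet h t, poissonWeight k s := by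
  have h1 := profileCoeff_eq_integral_slices hh (hh.measurableSet_levelRegion (ε := 0))
    (fun p hp => ⟨hp.1, hp.2.1⟩) (fun s hs => by
      have e1 : {t : ℝ | (t, s) ∈ {p : ℝ × ℝ | 0 < p.1 ∧ 0 < p.2 ∧ p.1 < h p.2}}
          = Ioo 0 (h s) := by
        ext t; exact and_congr_right fun _ => and_iff_right hs
      rw [e1, Real.volume_Ioo, sub_zero]) k
  have h2 : EqOn (fun t => ∫ s in {s | (t, s) ∈ {p : ℝ × ℝ | 0 < p.1 ∧ 0 < p.2 ∧ p.1 < h p.2}},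
      poissonWeight k s) (fun t => ∫ s in profileLevelSet h t, poissonWeight k s) (Ioi 0) := by
    intro t ht
    have e1 : {s : ℝ | (t, s) ∈ {p : ℝ × ℝ | 0 < p.1 ∧ 0 < p.2 ∧ p.1 < h p.2}}
        = profileLevelSet h t := by
      ext s; exact and_iff_right ht
    simp only [e1]
  exact ⟨h1.1.congr_fun h2 measurableSet_Ioi,
    h1.2.trans (setIntegral_congr_fun measurableSet_Ioi h2)⟩

lemma profileCoeff_rearrangedProfile (hh : IsAdmissibleProfile h) (k : ℕ) :
    IntegrableOn (fun t => poissonTail k (profileDistribution h t)) (Ioi 0) ∧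
      profileCoeff (rearrangedProfile h) k
        = ∫ t in Ioi 0, poissonTail k (profileDistribution h t) := by
  have h1 := profileCoeff_eq_integral_slices hh.rearranged
    (measurableSet_rearrangedRegion h (ε := 0))
    (fun p hp => ⟨hp.1, hp.2.1⟩) (fun s hs => by
      rw [hh.ofReal_rearrangedProfile hs]
      congr 1
      ext t; exact and_congr_right fun _ => and_iff_right hs) k
  have h2 : EqOn (fun t => ∫ s in {s | (t, s) ∈
        {p : ℝ × ℝ | 0 < p.1 ∧ 0 < p.2 ∧ p.2 < profileDistribution h p.1}}, poissonWeight k s)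
      (fun t => poissonTail k (profileDistribution h t)) (Ioi 0) := by
    intro t ht
    have e1 : {s : ℝ | (t, s) ∈
        {p : ℝ × ℝ | 0 < p.1 ∧ 0 < p.2 ∧ p.2 < profileDistribution h p.1}}
        = Ioo 0 (profileDistribution h t) := by
      ext s; exact and_iff_right ht
    simp only [e1]
    rw [← integral_Ioc_eq_integral_Ioo,
      ← intervalIntegral.integral_of_le (profileDistribution_nonneg h t), integral_poissonWeight]
  exact ⟨h1.1.congr_fun h2 measurableSet_Ioi,
    h1.2.trans (setIntegral_congr_fun measurableSet_Ioi h2)⟩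

lemma antitone_profileCoeff_rearrangedProfile (hh : IsAdmissibleProfile h) :
    Antitone (profileCoeff (rearrangedProfile h)) := by
  refine antitone_nat_of_succ_le fun k => ?_
  rw [(hh.profileCoeff_rearrangedProfile k).2, (hh.profileCoeff_rearrangedProfile (k + 1)).2]
  refine setIntegral_mono (hh.profileCoeff_rearrangedProfile (k + 1)).1
    (hh.profileCoeff_rearrangedProfile k).1 fun t => ?_
  rw [poissonTail_succ]
  linarith [poissonWeight_nonneg (k + 1) (profileDistribution_nonneg h t)]

/-- The eigenvalues of a rearranged nonzero symbol are simple. -/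
lemma strictAnti_profileCoeff_rearrangedProfile (hh : IsAdmissibleProfile h)
    (hne : ¬ ∀ᵐ s : ℝ, 0 < s → h s = 0) :
    StrictAnti (profileCoeff (rearrangedProfile h)) := by
  refine strictAnti_nat_of_succ_lt fun k =>
    lt_of_le_of_ne (hh.antitone_profileCoeff_rearrangedProfile (Nat.le_succ k)) fun heq => hne ?_
  have hi := hh.profileCoeff_rearrangedProfile k
  have hi' := hh.profileCoeff_rearrangedProfile (k + 1)
  -- The gap between consecutive coefficients is the integral of `w_{k+1}(μ(t))`, and `w_{k+1}` is
  -- positive off zero. A vanishing gap thus gives `μ = 0` almost everywhere, then everywhere by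
  -- monotonicity.
  have h0 : ∫ t in Ioi 0, poissonWeight (k + 1) (profileDistribution h t) = 0 := by
    have e1 : (fun t => poissonWeight (k + 1) (profileDistribution h t)) = fun t =>
        poissonTail k (profileDistribution h t)
          - poissonTail (k + 1) (profileDistribution h t) := by
      ext t; rw [poissonTail_succ]; ring
    rw [e1, integral_sub hi.1 hi'.1, ← hi.2, ← hi'.2, heq, sub_self]
  have hint : IntegrableOn (fun t => poissonWeight (k + 1) (profileDistribution h t)) (Ioi 0) := by
    refine (hi.1.sub hi'.1).congr (Filter.Eventually.of_forall fun t => ?_)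
    rw [Pi.sub_apply, poissonTail_succ]; ring
  rw [integral_eq_zero_iff_of_nonneg
    (fun t => poissonWeight_nonneg _ (profileDistribution_nonneg h t)) hint] at h0
  have hD : ∀ t, 0 < t → volume (profileLevelSet h t) = 0 := by
    intro t ht
    have h1 : ∀ᵐ t' ∂volume.restrict (Ioo 0 t), profileDistribution h t' = 0 := by
      filter_upwards [ae_restrict_of_ae_restrict_of_subset Ioo_subset_Ioi_self h0] with t' ht'
      by_contra hcon
      exact (poissonWeight_pos (k + 1)
        (lt_of_le_of_ne (profileDistribution_nonneg h t') (Ne.symm hcon))).ne' ht'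
    have hnb : Filter.NeBot (ae (volume.restrict (Ioo 0 t))) := by
      rw [ae_neBot, Ne, Measure.restrict_eq_zero, Real.volume_Ioo]
      simpa using ht
    obtain ⟨t', ht', hmem⟩ := (h1.and (ae_restrict_mem measurableSet_Ioo)).exists
    have h2 := hh.profileDistribution_anti hmem.1 hmem.2.le
    rw [← hh.ofReal_profileDistribution ht, ENNReal.ofReal_eq_zero]
    linarith
  have hall : ∀ᵐ s : ℝ, ∀ m : ℕ, s ∉ profileLevelSet h (1 / ((m : ℝ) + 1)) :=
    ae_all_iff.2 fun m => measure_eq_zero_iff_ae_notMem.1 (hD _ (by positivity))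
  filter_upwards [hall] with s hs hs0
  by_contra hcon
  obtain ⟨m, hm⟩ := exists_nat_one_div_lt (lt_of_le_of_ne (hh.nonneg s) (Ne.symm hcon))
  exact hs m ⟨hs0, hm⟩

lemma integrableOn_eigenvalueSumBound (hh : IsAdmissibleProfile h) (n : ℕ) :
    IntegrableOn (fun t => eigenvalueSumBound n (profileDistribution h t)) (Ioi 0) := by
  simp only [eigenvalueSumBound_eq_sum]
  exact integrable_finsetSum _ fun k _ => (hh.profileCoeff_rearrangedProfile k).1

lemma sum_profileCoeff_rearrangedProfile (hh : IsAdmissibleProfile h) (n : ℕ) :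
    ∑ k ∈ Finset.range n, profileCoeff (rearrangedProfile h) k
      = ∫ t in Ioi 0, eigenvalueSumBound n (profileDistribution h t) := by
  simp only [eigenvalueSumBound_eq_sum]
  rw [integral_finsetSum _ fun k _ => (hh.profileCoeff_rearrangedProfile k).1]
  exact Finset.sum_congr rfl fun k _ => (hh.profileCoeff_rearrangedProfile k).2

lemma sum_profileCoeff_eq (hh : IsAdmissibleProfile h) (K : Finset ℕ) :
    IntegrableOn (fun t => ∑ k ∈ K, ∫ s in profileLevelSet h t, poissonWeight k s) (Ioi 0) ∧
    ∑ k ∈ K, profileCoeff h k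
      = ∫ t in Ioi 0, ∑ k ∈ K, ∫ s in profileLevelSet h t, poissonWeight k s := by
  refine ⟨integrable_finsetSum _ fun k _ => (hh.profileCoeff_eq_integral_levelSet k).1, ?_⟩
  rw [integral_finsetSum _ fun k _ => (hh.profileCoeff_eq_integral_levelSet k).1]
  exact Finset.sum_congr rfl fun k _ => (hh.profileCoeff_eq_integral_levelSet k).2

lemma ae_sum_setIntegral_levelSet_le (hh : IsAdmissibleProfile h) (K : Finset ℕ) :
    (fun t => ∑ k ∈ K, ∫ s in profileLevelSet h t, poissonWeight k s)
      ≤ᵐ[volume.restrict (Ioi 0)] fun t => eigenvalueSumBound K.card (profileDistribution h t) :=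
  (ae_restrict_iff' measurableSet_Ioi).2 (Filter.Eventually.of_forall fun t ht =>
    sum_setIntegral_poissonWeight_le (hh.measurableSet_levelSet t)
      (hh.volume_levelSet_ne_top ht) (fun _ hs => hs.1) K)

theorem sum_profileCoeff_le (hh : IsAdmissibleProfile h) (K : Finset ℕ) :
    ∑ k ∈ K, profileCoeff h k
      ≤ ∑ k ∈ Finset.range K.card, profileCoeff (rearrangedProfile h) k := by
  rw [(hh.sum_profileCoeff_eq K).2, hh.sum_profileCoeff_rearrangedProfile]
  exact integral_mono_ae (hh.sum_profileCoeff_eq K).1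
    (hh.integrableOn_eigenvalueSumBound K.card) (hh.ae_sum_setIntegral_levelSet_le K)

/-- Equality of the integrals forces equality at almost every level, so almost every level set is an
initial interval. After exchanging the quantifiers, for almost every `s` the interval `(0, h(s))`
agrees almost everywhere with the set of levels `t` where `s < μ(t)`, and lengths are compared. -/
theorem ae_eq_rearrangedProfile_of_sum_eq (hh : IsAdmissibleProfile h) {K : Finset ℕ}
    (hK : K.Nonempty) (heq : ∑ k ∈ K, profileCoeff h k
      = ∑ k ∈ Finset.range K.card, profileCoeff (rearrangedProfile h) k) :
    ∀ᵐ s : ℝ, 0 < s → h s = rearrangedProfile h s := by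
  rw [(hh.sum_profileCoeff_eq K).2, hh.sum_profileCoeff_rearrangedProfile,
    integral_eq_iff_of_ae_le (hh.sum_profileCoeff_eq K).1
    (hh.integrableOn_eigenvalueSumBound K.card) (hh.ae_sum_setIntegral_levelSet_le K)] at heq
  have h1 : ∀ᵐ t : ℝ, ∀ᵐ s : ℝ, 0 < t → 0 < s → (t < h s ↔ s < profileDistribution h t) := by
    filter_upwards [(ae_restrict_iff' measurableSet_Ioi).1 heq] with t ht
    by_cases ht0 : 0 < t
    · filter_upwards [ae_mem_iff_lt_of_sum_setIntegral_poissonWeight_eq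
        (hh.measurableSet_levelSet t) (hh.volume_levelSet_ne_top ht0) (fun _ hs => hs.1) hK
        (ht ht0)] with s hs _ hs0
      rw [← profileDistribution] at hs
      rw [← hs hs0]
      exact (and_iff_right hs0).symm
    · exact Filter.Eventually.of_forall fun s h0 => absurd h0 ht0
  have hm1 : MeasurableSet {p : ℝ × ℝ | p.1 < h p.2} :=
    measurableSet_lt measurable_fst (hh.measurable.comp measurable_snd)
  have hm2 : MeasurableSet {p : ℝ × ℝ | p.2 < profileDistribution h p.1} :=
    measurableSet_lt measurable_snd ((measurable_profileDistribution h).comp measurable_fst)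
  have hmeas : MeasurableSet {p : ℝ × ℝ | 0 < p.1 → 0 < p.2 →
      (p.1 < h p.2 ↔ p.2 < profileDistribution h p.1)} :=
    (measurableSet_lt measurable_const measurable_fst).imp
      ((measurableSet_lt measurable_const measurable_snd).imp (hm1.iff hm2))
  rw [Measure.ae_ae_comm (p := fun t s => 0 < t → 0 < s →
    (t < h s ↔ s < profileDistribution h t)) hmeas] at h1
  filter_upwards [h1] with s hs hs0
  have e1 : (Ioo 0 (h s) : Set ℝ) =ᵐ[volume] {t : ℝ | 0 < t ∧ s < profileDistribution h t} := by
    filter_upwards [hs] with t ht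
    refine propext (and_congr_right fun h0 => ?_)
    exact ht h0 hs0
  rw [rearrangedProfile, ← measureReal_congr e1, Real.volume_real_Ioo_of_le (hh.nonneg s),
    sub_zero]

end IsAdmissibleProfile

/-! ### Radial symbols and their decreasing rearrangements -/

lemma volume_superlevel_eq {h : ℝ → ℝ} (hh : IsAdmissibleProfile h) {σ : ℂ → ℝ}
    (hσ : σ =ᵐ[volume] fun z => h (areaCoord z)) (t : ℝ) :
    volume {z : ℂ | t < σ z} = volume (profileLevelSet h t) := by
  have hm : MeasurableSet {s | t < h s} := measurableSet_lt measurable_const hh.measurable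
  have e1 : ({z : ℂ | t < σ z} : Set ℂ) =ᵐ[volume] areaCoord ⁻¹' {s | t < h s} := by
    filter_upwards [hσ] with z hz
    refine propext ?_
    change t < σ z ↔ t < h (areaCoord z)
    rw [hz]
  rw [measure_congr e1, measurePreserving_areaCoord.measure_preimage hm.nullMeasurableSet,
    Measure.restrict_apply hm, inter_comm]
  rfl

lemma distributionFunction_eq {h : ℝ → ℝ} (hh : IsAdmissibleProfile h) {σ : ℂ → ℝ}
    (hσ : σ =ᵐ[volume] fun z => h (areaCoord z)) :
    distributionFunction σ = profileDistribution h := by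
  ext t
  rw [distributionFunction, volume_superlevel_eq hh hσ, profileDistribution, measureReal_def]

lemma decreasingRearrangement_eq {h : ℝ → ℝ} (hh : IsAdmissibleProfile h) {σ : ℂ → ℝ}
    (hσ : σ =ᵐ[volume] fun z => h (areaCoord z)) :
    decreasingRearrangement σ = fun z => rearrangedProfile h (areaCoord z) := by
  ext z
  have hm : MeasurableSet {t : ℝ | 0 < t ∧ areaCoord z < profileDistribution h t} :=
    measurableSet_Ioi.inter
      (measurableSet_lt measurable_const (measurable_profileDistribution h))
  have e1 : EqOn (fun t => (setRearrangement {w : ℂ | t < σ w}).indicator (fun _ => (1 : ℝ)) z)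
      ({t : ℝ | 0 < t ∧ areaCoord z < profileDistribution h t}.indicator fun _ => (1 : ℝ))
      (Ioi 0) := by
    intro t ht
    have hiff : z ∈ setRearrangement {w : ℂ | t < σ w} ↔
        t ∈ {t : ℝ | 0 < t ∧ areaCoord z < profileDistribution h t} := by
      change ENNReal.ofReal (areaCoord z) < volume {w : ℂ | t < σ w} ↔
        0 < t ∧ areaCoord z < profileDistribution h t
      rw [volume_superlevel_eq hh hσ, ← hh.ofReal_profileDistribution ht,
        ENNReal.ofReal_lt_ofReal_iff_of_nonneg (areaCoord_nonneg z)]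
      exact (and_iff_right ht).symm
    by_cases hz : z ∈ setRearrangement {w : ℂ | t < σ w}
    · simp only [indicator_of_mem hz, indicator_of_mem (hiff.1 hz)]
    · simp only [indicator_of_notMem hz, indicator_of_notMem (mt hiff.2 hz)]
  rw [decreasingRearrangement, setIntegral_congr_fun measurableSet_Ioi e1,
    setIntegral_indicator hm, setIntegral_const, smul_eq_mul, mul_one, rearrangedProfile]
  congr 1
  exact inter_eq_right.2 fun t ht => ht.1

theorem theorem5p1 (p : ℝ≥0∞) (hp_one : 1 ≤ p) (hp_top : p ≠ ∞)
    (σ : ℂ → ℝ) (hσ : MemLp σ p volume) (hσ_nonneg : ∀ᵐ z : ℂ, 0 ≤ σ z)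
    (hσ_radial : IsRadialSymbol σ) (n : ℕ) (hn : 1 ≤ n) :
    (∑ k ∈ Finset.Icc 1 n, toeplitzEigenvalue σ k
        ≤ ∑ k ∈ Finset.Icc 1 n, toeplitzEigenvalue (decreasingRearrangement σ) k) ∧
    (IntegrableOn (fun t => eigenvalueSumBound n (distributionFunction σ t)) (Ioi (0 : ℝ)) ∧
      ∑ k ∈ Finset.Icc 1 n, toeplitzEigenvalue (decreasingRearrangement σ) k
        = ∫ t in Ioi (0 : ℝ), eigenvalueSumBound n (distributionFunction σ t)) ∧
    (∑ k ∈ Finset.Icc 1 n, toeplitzEigenvalue σ k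
        = ∑ k ∈ Finset.Icc 1 n, toeplitzEigenvalue (decreasingRearrangement σ) k ↔
      ∀ᵐ z : ℂ, σ z = decreasingRearrangement σ z) ∧
    ((¬ ∀ᵐ z : ℂ, σ z = 0) → ∀ F : ℂ → ℂ,
      IsToeplitzEigenfunction (decreasingRearrangement σ)
          (toeplitzEigenvalue (decreasingRearrangement σ) n) F ↔
        ∃ c : ℂ, c ≠ 0 ∧ F = c • fockMonomial (n - 1)) := by
  obtain ⟨h, hh, hσh⟩ := exists_isAdmissibleProfile hp_one hp_top hσ hσ_nonneg hσ_radial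
  -- The largest coefficients of `h` need not sit at the lowest indices, hence `e`. For the
  -- rearranged profile the identity enumeration suffices.
  obtain ⟨e, he⟩ := exists_isDecreasingEnumeration hh.profileCoeff_nonneg hh.tendsto_profileCoeff
  have hid := hh.antitone_profileCoeff_rearrangedProfile.isDecreasingEnumeration_id
  have hleft : ∑ k ∈ Finset.Icc 1 n, toeplitzEigenvalue σ k
      = ∑ k ∈ (Finset.range n).image e, profileCoeff h k := by
    rw [← hh.sum_toeplitzEigenvalue he]
    exact Finset.sum_congr rfl fun k _ => toeplitzEigenvalue_congr_ae hσh k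
  have hright : ∑ k ∈ Finset.Icc 1 n, toeplitzEigenvalue (decreasingRearrangement σ) k
      = ∑ k ∈ Finset.range n, profileCoeff (rearrangedProfile h) k := by
    rw [decreasingRearrangement_eq hh hσh, hh.rearranged.sum_toeplitzEigenvalue hid,
      Finset.image_id]
  have hcard : ((Finset.range n).image e).card = n := by
    rw [Finset.card_image_of_injective _ he.1, Finset.card_range]
  refine ⟨?_, ⟨?_, ?_⟩, ⟨fun heq => ?_, fun hae => ?_⟩, fun hne F => ?_⟩
  · rw [hleft, hright]
    simpa only [hcard] using hh.sum_profileCoeff_le ((Finset.range n).image e)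
  · rw [distributionFunction_eq hh hσh]
    exact hh.integrableOn_eigenvalueSumBound n
  · rw [hright, distributionFunction_eq hh hσh, hh.sum_profileCoeff_rearrangedProfile]
  · rw [hleft, hright] at heq
    have hK : ((Finset.range n).image e).Nonempty := by
      rw [← Finset.card_pos, hcard]; omega
    have h1 := ae_areaCoord_of_ae
      (hh.ae_eq_rearrangedProfile_of_sum_eq hK (by simpa only [hcard] using heq))
    rw [decreasingRearrangement_eq hh hσh]
    filter_upwards [hσh, h1] with z hz1 hz2
    rw [hz1, hz2]
  · exact Finset.sum_congr rfl fun k _ => toeplitzEigenvalue_congr_ae hae k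
  -- Eigenvalues are numbered from `1`, monomials from `0`. Strict decrease makes the `m`-th
  -- coefficient attained only at `m`.
  · obtain ⟨m, rfl⟩ : ∃ m, n = m + 1 := ⟨n - 1, by omega⟩
    have hanti := hh.strictAnti_profileCoeff_rearrangedProfile fun h0 => hne (by
      filter_upwards [hσh, ae_areaCoord_of_ae h0] with z hz1 hz2
      rw [hz1, hz2])
    rw [decreasingRearrangement_eq hh hσh, hh.rearranged.toeplitzEigenvalue_succ hid,
      Nat.add_sub_cancel]
    exact hh.rearranged.isToeplitzEigenfunction_iff (fun j hj => hanti.injective hj) F
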